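/- Let $M$ be a smooth ($C^\infty$, Hausdorff, $\sigma$-compact, without boundary) manifold of dimension $n$, let $g$ be a continuous Lorentzian metric on $M$ (signature $(-,+,\dots,+)$) such that $(M,g)$ admits a continuous timelike vector field, i.e. is time-orientable, and let $h$ be a smooth Riemannian metric on $M$. For Lorentzian metrics $g_1,g_2$ write $g_1\prec g_2$ if every tangent vector $X\neq 0$ with $g_1(X,X)\le 0$ satisfies $g_2(X,X)<0$, and for symmetric $(0,2)$-tensor fields $g_1,g_2$ put $$d_h(g_1,g_2):=\sup_{p\in M}\ \sup_{0\ne X,Y\in T_pM}\frac{|g_1(X,Y)-g_2(X,Y)|}{\|X\|_h\,\|Y\|_h}\in[0,\infty].$$ Then there are families $(\check g_\varepsilon)_{\varepsilon>0}$ and $(\hat g_\varepsilon)_{\varepsilon>0}$ of smooth Lorentzian metrics on $M$ such that: (a) for every $\varepsilon>0$, $\ \check g_\varepsilon\prec g\prec\hat g_\varepsilon$ and $d_h(\check g_\varepsilon,g)+d_h(\hat g_\varepsilon,g)<\varepsilon$; (b) $\check g_\varepsilon$ and $\hat g_\varepsilon$ depend smoothly on $\varepsilon$, i.e. the maps $(\varepsilon,p)\mapsto\check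 g_\varepsilon(p)$ and $(\varepsilon,p)\mapsto\hat g_\varepsilon(p)$ from $(0,\infty)\times M$ to the bundle $T^0_2M$ of $(0,2)$-tensors are smooth; (c) if moreover $g$ is of class $C^{1,1}$ (in every smooth chart its components are $C^1$ with locally Lipschitz first derivatives), then, for both $g_\varepsilon=\check g_\varepsilon$ and $g_\varepsilon=\hat g_\varepsilon$: (i) $g_\varepsilon\to g$ in the $C^1$-topology as $\varepsilon\to0$, i.e. in every smooth chart the components of $g_\varepsilon$ and their first derivatives converge to those of $g$ uniformly on compact subsets of the chart; and (ii) in every smooth chart the second derivatives of the components of $g_\varepsilon$ are bounded on each compact subset of the chart, uniformly in $\varepsilon>0$. -/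

import Mathlib

open Set Filter Topology Bundle
open scoped Manifold ContDiff ENNReal

noncomputable section

namespace LorentzApprox

/-- The model space `ℝⁿ`. -/
abbrev E (n : ℕ) : Type := EuclideanSpace ℝ (Fin n)

variable {n : ℕ} {M : Type*} [TopologicalSpace M] [ChartedSpace (E n) M]

/-- The fibre of `T⁰₂ M` at `p`: bilinear forms on the tangent space `T_p M`. -/
abbrev BilinAt (n : ℕ) {M : Type*} [TopologicalSpace M] [ChartedSpace (E n) M] (p : M) : Type :=
  TangentSpace (𝓡 n) p →L[ℝ] TangentSpace (𝓡 n) p →L[ℝ] ℝ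

/-- `(0,2)`-tensor fields on `M`, with no regularity imposed. -/
abbrev TensorField (n : ℕ) (M : Type*) [TopologicalSpace M] [ChartedSpace (E n) M] : Type _ :=
  ∀ p : M, BilinAt n p

/-- The tensor field `g` is continuous, as a map from `M` to the total space of `T⁰₂ M`. -/
def TensorField.IsContinuous [IsManifold (𝓡 n) ∞ M] (g : TensorField n M) : Prop :=
  Continuous (fun p : M =>
    (TotalSpace.mk' (E n →L[ℝ] E n →L[ℝ] ℝ) p (g p) :
      TotalSpace (E n →L[ℝ] E n →L[ℝ] ℝ) (fun p : M => BilinAt n p)))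

/-- The tensor field `g` is smooth, as a map from `M` to the total space of `T⁰₂ M`. -/
def TensorField.IsSmooth [IsManifold (𝓡 n) ∞ M] (g : TensorField n M) : Prop :=
  ContMDiff (𝓡 n) ((𝓡 n).prod 𝓘(ℝ, E n →L[ℝ] E n →L[ℝ] ℝ)) ∞ (fun p : M =>
    (TotalSpace.mk' (E n →L[ℝ] E n →L[ℝ] ℝ) p (g p) :
      TotalSpace (E n →L[ℝ] E n →L[ℝ] ℝ) (fun p : M => BilinAt n p)))

/-- The family `(g_ε)` depends smoothly on `ε > 0`: the map `(ε, p) ↦ g_ε(p)` from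
`(0, ∞) × M` to the total space of `T⁰₂ M` is smooth. -/
def SmoothFamily [IsManifold (𝓡 n) ∞ M] (g : ℝ → TensorField n M) : Prop :=
  ContMDiffOn (𝓘(ℝ, ℝ).prod (𝓡 n)) ((𝓡 n).prod 𝓘(ℝ, E n →L[ℝ] E n →L[ℝ] ℝ)) ∞
    (fun q : ℝ × M =>
      (TotalSpace.mk' (E n →L[ℝ] E n →L[ℝ] ℝ) q.2 (g q.1 q.2) :
        TotalSpace (E n →L[ℝ] E n →L[ℝ] ℝ) (fun p : M => BilinAt n p)))
    (Ioi (0 : ℝ) ×ˢ (univ : Set M))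

/-- `g` is pointwise symmetric of signature `(-,+,…,+)`: at each point there is a vector `v` with
`g(v,v) < 0` on whose `g`-orthogonal complement (a complement of `ℝ v`) `g` is positive definite. -/
def TensorField.IsLorentzian (g : TensorField n M) : Prop :=
  ∀ p : M, (∀ X Y : TangentSpace (𝓡 n) p, g p X Y = g p Y X) ∧
    ∃ v : TangentSpace (𝓡 n) p, g p v v < 0 ∧
      ∀ w : TangentSpace (𝓡 n) p, w ≠ 0 → g p v w = 0 → 0 < g p w w

/-- There is a continuous `g`-timelike vector field on `M`. -/
def TensorField.TimeOrientable [IsManifold (𝓡 n) ∞ M] (g : TensorField n M) : Prop :=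
  ∃ X : ∀ p : M, TangentSpace (𝓡 n) p,
    Continuous (fun p : M => (⟨p, X p⟩ : TangentBundle (𝓡 n) M)) ∧ ∀ p : M, g p (X p) (X p) < 0

/-- `g₁ ≺ g₂`: the metric `g₂` has strictly larger light cones than `g₁`. -/
def StrictlyLargerCones (g₁ g₂ : TensorField n M) : Prop :=
  ∀ (p : M) (X : TangentSpace (𝓡 n) p), X ≠ 0 → g₁ p X X ≤ 0 → g₂ p X X < 0

/-- The distance of `g₁` and `g₂` with respect to the Riemannian metric `h`: the supremum of
`|g₁(X,Y) - g₂(X,Y)| / (‖X‖_h ‖Y‖_h)` over nonzero tangent vectors `X, Y` at a common point. -/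
def distWrt [IsManifold (𝓡 n) ∞ M]
    (h : ContMDiffRiemannianMetric (𝓡 n) ∞ (E n) (fun p : M => TangentSpace (𝓡 n) p))
    (g₁ g₂ : TensorField n M) : ℝ≥0∞ :=
  ⨆ (p : M) (X : TangentSpace (𝓡 n) p) (Y : TangentSpace (𝓡 n) p) (_ : X ≠ 0) (_ : Y ≠ 0),
    ENNReal.ofReal
      (|g₁ p X Y - g₂ p X Y| / (Real.sqrt (h.inner p X X) * Real.sqrt (h.inner p Y Y)))

/-- The component `g(∂ᵢ, ∂ⱼ)` of `g` in the chart `φ`, as a function on `φ.target ⊆ ℝⁿ`. -/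
def component (g : TensorField n M) (φ : OpenPartialHomeomorph M (E n)) (i j : Fin n) (x : E n) :
    ℝ :=
  g (φ.symm x)
    (mfderiv (𝓡 n) (𝓡 n) φ.symm x (EuclideanSpace.single i (1 : ℝ) : E n))
    (mfderiv (𝓡 n) (𝓡 n) φ.symm x (EuclideanSpace.single j (1 : ℝ) : E n))

/-- `g` is of class `C^{1,1}`: in each smooth chart its components are continuously differentiable
with locally Lipschitz first derivatives. -/
def TensorField.IsC11 (g : TensorField n M) : Prop :=
  ∀ φ ∈ IsManifold.maximalAtlas (𝓡 n) ∞ M, ∀ i j : Fin n,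
    ContDiffOn ℝ 1 (component g φ i j) φ.target ∧
      LocallyLipschitzOn φ.target (fderiv ℝ (component g φ i j))

/-- `g_ε → g` as `ε → 0⁺` in the (compact-open) `C¹`-topology: in each smooth chart the components
and their first derivatives converge uniformly on compact sets. -/
def ConvergesC1 (gε : ℝ → TensorField n M) (g : TensorField n M) : Prop :=
  ∀ φ ∈ IsManifold.maximalAtlas (𝓡 n) ∞ M, ∀ K : Set (E n), IsCompact K → K ⊆ φ.target →
    ∀ i j : Fin n,
      TendstoUniformlyOn (fun ε => component (gε ε) φ i j) (component g φ i j) (𝓝[>] 0) K ∧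
      TendstoUniformlyOn (fun ε => fderiv ℝ (component (gε ε) φ i j))
        (fderiv ℝ (component g φ i j)) (𝓝[>] 0) K

/-- The second derivatives of `g_ε` are bounded on compact sets, uniformly in `ε > 0`. -/
def SecondDerivBounded (gε : ℝ → TensorField n M) : Prop :=
  ∀ φ ∈ IsManifold.maximalAtlas (𝓡 n) ∞ M, ∀ K : Set (E n), IsCompact K → K ⊆ φ.target →
    ∃ C : ℝ, ∀ ε : ℝ, 0 < ε → ∀ x ∈ K, ∀ i j : Fin n,
      ‖iteratedFDeriv ℝ 2 (component (gε ε) φ i j) x‖ ≤ C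

end LorentzApprox

end

/-! Let `T` be timelike for `g` and `θ = g T`. For suitable `K > 0` the form `P = g + K θ ⊗ θ` is
positive definite, and `K (g + lam θ ⊗ θ) = (K - lam) g + lam P`, `K (g - lam θ ⊗ θ) = (K + lam) g -
lam P`. So for `0 < lam ≤ K` adding `lam θ ⊗ θ` narrows the light cone and subtracting it widens the
cone, with room for an error of size `κ * lam` (`exists_goodForm_nhds`). Near each point one
therefore mollifies `g` in a chart to accuracy `κ * lam` (`exists_smooth_approx`) and adds `σ * lam`
times a constant `θ ⊗ θ`, where `σ = 1` gives narrower and `σ = -1` wider cones.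

The local pieces have to be joined across charts and across values of `ε`. Both are done by convex
combinations in the fibres. Symmetry, the cone condition and closeness to `g` are convex conditions;
being Lorentzian is not. `GoodForm` therefore asks for closeness to `g` within a radius in which
every symmetric form is Lorentzian, and this is convex (`convex_goodForm`). Hence a partition of
unity glues local families whose `θ` are unrelated, and `interp` turns the sequence `lam = Λ / (k +
1)` into a family smooth in `ε`.

If `Dg` is locally `L`-Lipschitz, mollifying at scale `δ` moves it by at most `L * δ` and keeps the
second derivative below `L`, while the correction is constant in the chart. These bounds are convex
too, so they survive interpolation. They pass to every chart because the glued tensor is locally a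
finite sum of fixed smooth operators applied to the local pieces (`exists_rep_glue`). -/

noncomputable section

namespace LorentzApprox

/-! ### Mollification with first and second derivative bounds -/

section Mollify

open MeasureTheory Metric ContinuousLinearMap
open scoped Convolution

variable {V W : Type*} [NormedAddCommGroup V] [NormedSpace ℝ V] [FiniteDimensional ℝ V]
  [MeasurableSpace V] [BorelSpace V] [NormedAddCommGroup W] [NormedSpace ℝ W]

theorem norm_integral_normed_smul_le (μ : Measure V) [μ.IsAddHaarMeasure]
    (ρ : ContDiffBump (0 : V)) {v : V → W} {C : ℝ}
    (hv : ∀ t ∈ ball (0 : V) ρ.rOut, ‖v t‖ ≤ C) :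
    ‖∫ t, ρ.normed μ t • v t ∂μ‖ ≤ C := by
  have h1 : ‖∫ t, ρ.normed μ t • v t ∂μ‖ ≤ ∫ t, ρ.normed μ t * C ∂μ := by
    refine norm_integral_le_of_norm_le (ρ.integrable_normed.mul_const C) (ae_of_all _ fun t => ?_)
    rw [norm_smul, Real.norm_of_nonneg (ρ.nonneg_normed t)]
    by_cases ht : t ∈ ball (0 : V) ρ.rOut
    · exact mul_le_mul_of_nonneg_left (hv t ht) (ρ.nonneg_normed t)
    · have : ρ.normed μ t = 0 := by
        rw [← Function.notMem_support, ρ.support_normed_eq]; exact ht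
      simp [this]
  rwa [integral_mul_const, ρ.integral_normed, one_mul] at h1

/-- Averaging translates of `G` against a bump preserves every linear identity satisfied by its
values and every Lipschitz bound. `A` will be the flip of bilinear forms, so that symmetry is kept.
`F` is chosen before `L`: one mollification serves both the continuous and the `C^{1,1}` case. -/
theorem exists_smooth_approx [CompleteSpace W] (x₀ : V) {r : ℝ} (hr : 0 < r) {G : V → W}
    (hG : ContinuousOn G (closedBall x₀ (2 * r))) {δ : ℝ} (hδ : 0 < δ) :
    ∃ F : V → W, ContDiff ℝ ∞ F ∧ (∀ x ∈ ball x₀ r, ‖F x - G x‖ ≤ δ) ∧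
      (∀ A : W →L[ℝ] W, (∀ x ∈ closedBall x₀ (2 * r), A (G x) = G x) → ∀ x, A (F x) = F x) ∧
      ∀ L : ℝ, 0 ≤ L → DifferentiableOn ℝ G (ball x₀ (2 * r)) →
        (∀ x ∈ ball x₀ (2 * r), ∀ y ∈ ball x₀ (2 * r), ‖fderiv ℝ G x - fderiv ℝ G y‖ ≤ L * ‖x - y‖) →
        ∀ x ∈ ball x₀ r, ‖fderiv ℝ F x - fderiv ℝ G x‖ ≤ L * δ ∧
          ‖fderiv ℝ (fderiv ℝ F) x‖ ≤ L := by
  let μ : Measure V := Measure.addHaar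
  have hcomp : IsCompact (closedBall x₀ (2 * r)) := isCompact_closedBall _ _
  obtain ⟨η₀, hη₀, huc⟩ := Metric.uniformContinuousOn_iff_le.1
    (hcomp.uniformContinuousOn_of_continuous hG) δ hδ
  -- The mollification radius: `η₀` gives uniform accuracy `δ`, `δ` gives the derivative error `L *
  -- δ`, and `r` keeps `x - t` in the doubled ball.
  set η : ℝ := min (min η₀ δ) r with hη
  have hηpos : 0 < η := by positivity
  have hη1 : η ≤ η₀ := (min_le_left _ _).trans (min_le_left _ _)
  have hη2 : η ≤ δ := (min_le_left _ _).trans (min_le_right _ _)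
  have hη3 : η ≤ r := min_le_right _ _
  let ρ : ContDiffBump (0 : V) := ⟨η / 2, η, by positivity, by linarith⟩
  -- The cut-off makes the function integrable; it is invisible for `x` in the ball of radius `r`.
  set G' : V → W := indicator (closedBall x₀ (2 * r)) G with hG'
  have hG'eq : ∀ x ∈ closedBall x₀ (2 * r), G' x = G x := fun x hx => indicator_of_mem hx G
  have hint : Integrable G' μ :=
    (hG.integrableOn_compact hcomp).integrable_indicator isClosed_closedBall.measurableSet
  set F : V → W := fun x => ∫ t, ρ.normed μ t • G' (x - t) ∂μ with hF
  have hFc : F = (ρ.normed μ ⋆[lsmul ℝ ℝ, μ] G') := by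
    ext x; simp [hF, convolution]
  have hsmooth : ContDiff ℝ ∞ F := by
    rw [hFc]
    exact ρ.hasCompactSupport_normed.contDiff_convolution_left _ ρ.contDiff_normed
      hint.locallyIntegrable
  have hI : ∀ x, Integrable (fun t => ρ.normed μ t • G' (x - t)) μ := by
    intro x
    have := (ρ.hasCompactSupport_normed (μ := μ)).convolutionExists_left (lsmul ℝ ℝ)
      (ρ.contDiff_normed (n := 0)).continuous hint.locallyIntegrable x
    simpa [ConvolutionExistsAt] using this
  have hconst : ∀ w : W, ∫ t, ρ.normed μ t • w ∂μ = w := fun w => ρ.integral_normed_smul μ w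
  have hIc : ∀ w : W, Integrable (fun t => ρ.normed μ t • w) μ := fun w =>
    ρ.integrable_normed.smul_const w
  have h4 : ∀ {a b c d : V → W}, Integrable a μ → Integrable b μ → Integrable c μ →
      Integrable d μ → ∫ t, (a t - b t - (c t - d t)) ∂μ =
        ∫ t, a t ∂μ - ∫ t, b t ∂μ - (∫ t, c t ∂μ - ∫ t, d t ∂μ) := fun ha hb hc hd =>
    (integral_sub (ha.sub hb) (hc.sub hd)).trans
      (congrArg₂ _ (integral_sub ha hb) (integral_sub hc hd))
  have hmem : ∀ x ∈ ball x₀ r, ∀ t ∈ ball (0 : V) ρ.rOut, x - t ∈ ball x₀ (2 * r) := by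
    intro x hx t ht
    rw [mem_ball_iff_norm] at hx ⊢
    have ht' : ‖t‖ < η := by simpa using ht
    calc ‖x - t - x₀‖ = ‖(x - x₀) - t‖ := by congr 1; abel
      _ ≤ ‖x - x₀‖ + ‖t‖ := norm_sub_le _ _
      _ < 2 * r := by linarith
  have hsub : ball x₀ r ⊆ ball x₀ (2 * r) := ball_subset_ball (by linarith)
  refine ⟨F, hsmooth, ?_, ?_, ?_⟩
  · intro x hx
    have : F x - G x = ∫ t, ρ.normed μ t • (G' (x - t) - G x) ∂μ := by
      simp_rw [smul_sub]
      rw [integral_sub (hI x) (hIc _), hconst]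
    rw [this]
    refine norm_integral_normed_smul_le μ ρ fun t ht => ?_
    have hm := ball_subset_closedBall (hmem x hx t ht)
    rw [hG'eq _ hm, ← dist_eq_norm]
    refine huc _ hm _ (ball_subset_closedBall (hsub hx)) ?_
    have ht' : ‖t‖ < η := by simpa using ht
    rw [dist_eq_norm, show x - t - x = -t by abel, norm_neg]
    linarith
  · intro A hA x
    rw [hF]
    simp only
    rw [← A.integral_comp_comm (hI x)]
    congr 1
    ext t
    rw [map_smul]
    by_cases hx : x - t ∈ closedBall x₀ (2 * r)
    · rw [hG'eq _ hx, hA _ hx]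
    · rw [hG', indicator_of_notMem hx, map_zero]
  · intro L hL hd hlip
    have hda : ∀ y ∈ ball x₀ (2 * r), HasFDerivAt G (fderiv ℝ G y) y := fun y hy =>
      (hd.differentiableAt (isOpen_ball.mem_nhds hy)).hasFDerivAt
    intro x hx
    constructor
    · have hDF : DifferentiableAt ℝ F x := hsmooth.differentiable (by simp) x
      have hDG : DifferentiableAt ℝ G x := (hda x (hsub hx)).differentiableAt
      rw [← fderiv_fun_sub hDF hDG]
      -- No differentiation under the integral: `F - G` averages the functions `u ↦ G (u - t) - G
      -- u`, whose derivatives are at most `L * ‖t‖`.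
      refine norm_fderiv_le_of_lip' ℝ (by positivity) ?_
      filter_upwards [isOpen_ball.mem_nhds hx] with y hy
      have : F y - G y - (F x - G x) =
          ∫ t, ρ.normed μ t • ((G' (y - t) - G y) - (G' (x - t) - G x)) ∂μ := by
        simp_rw [smul_sub]
        rw [h4 (hI y) (hIc _) (hI x) (hIc _), hconst, hconst]
      rw [this]
      refine norm_integral_normed_smul_le μ ρ fun t ht => ?_
      rw [hG'eq _ (ball_subset_closedBall (hmem x hx t ht)),
        hG'eq _ (ball_subset_closedBall (hmem y hy t ht))]
      refine (convex_ball x₀ r).norm_image_sub_le_of_norm_hasFDerivWithin_le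
        (f := fun u => G (u - t) - G u) (f' := fun u => fderiv ℝ G (u - t) - fderiv ℝ G u)
        (fun u hu => ?_) (fun u hu => ?_) hx hy
      · refine (HasFDerivAt.sub ?_ (hda u (hsub hu))).hasFDerivWithinAt
        simpa [Function.comp_def] using (hda _ (hmem u hu t ht)).comp u ((hasFDerivAt_id u).sub_const t)
      · refine (hlip _ (hmem u hu t ht) _ (hsub hu)).trans ?_
        have ht' : ‖t‖ < η := by simpa using ht
        rw [show u - t - u = -t by abel, norm_neg]
        exact mul_le_mul_of_nonneg_left (by linarith) hL
    · refine norm_fderiv_le_of_lip' ℝ hL ?_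
      filter_upwards [isOpen_ball.mem_nhds hx] with y hy
      -- `fderiv F y - fderiv F x` is the derivative at `x` of `z ↦ F (z + k) - F z`, an average of
      -- increments of `G` that are Lipschitz with constant `L * ‖k‖`.
      set k : V := y - x with hk
      have hy' : y = x + k := by rw [hk]; abel
      have hDF : ∀ z, DifferentiableAt ℝ F z := hsmooth.differentiable (by simp)
      have hs : HasFDerivAt (fun z => F (z + k) - F z) (fderiv ℝ F y - fderiv ℝ F x) x := by
        refine HasFDerivAt.sub ?_ (hDF x).hasFDerivAt
        rw [hy']
        simpa [Function.comp_def] using (hDF (x + k)).hasFDerivAt.comp x ((hasFDerivAt_id x).add_const k)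
      rw [← hs.fderiv]
      refine norm_fderiv_le_of_lip' ℝ (by positivity) ?_
      have hS : IsOpen {z | z + k ∈ ball x₀ r} := isOpen_ball.preimage (by fun_prop)
      have hxS : x + k ∈ ball x₀ r := hy' ▸ hy
      have hSc : Convex ℝ (ball x₀ r ∩ {z | z + k ∈ ball x₀ r}) :=
        (convex_ball _ _).inter ((convex_ball x₀ r).translate_preimage_left k)
      filter_upwards [isOpen_ball.mem_nhds hx, hS.mem_nhds hxS] with z hz hzk
      have hzk : z + k ∈ ball x₀ r := hzk
      have : F (z + k) - F z - (F (x + k) - F x) =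
          ∫ t, ρ.normed μ t • ((G' (z + k - t) - G' (z - t)) - (G' (x + k - t) - G' (x - t))) ∂μ := by
        simp_rw [smul_sub]
        rw [h4 (hI _) (hI _) (hI _) (hI _)]
      rw [this]
      refine norm_integral_normed_smul_le μ ρ fun t ht => ?_
      rw [hG'eq _ (ball_subset_closedBall (hmem x hx t ht)),
        hG'eq _ (ball_subset_closedBall (hmem z hz t ht)),
        hG'eq _ (ball_subset_closedBall (hmem _ hxS t ht)),
        hG'eq _ (ball_subset_closedBall (hmem _ hzk t ht))]
      refine hSc.norm_image_sub_le_of_norm_hasFDerivWithin_le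
        (f := fun u => G (u + k - t) - G (u - t))
        (f' := fun u => fderiv ℝ G (u + k - t) - fderiv ℝ G (u - t))
        (fun u hu => ?_) (fun u hu => ?_) ⟨hx, hxS⟩ ⟨hz, hzk⟩
      · refine (HasFDerivAt.sub ?_ ?_).hasFDerivWithinAt
        · simpa [Function.comp_def] using (hda _ (hmem _ hu.2 t ht)).comp u
            (((hasFDerivAt_id u).add_const k).sub_const t)
        · simpa [Function.comp_def] using (hda _ (hmem u hu.1 t ht)).comp u ((hasFDerivAt_id u).sub_const t)
      · refine (hlip _ (hmem _ hu.2 t ht) _ (hmem u hu.1 t ht)).trans (le_of_eq ?_)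
        congr 2
        abel

end Mollify

/-! ### `C^m` bounds under change of coordinates; smooth interpolation of sequences -/

section Estimates

variable {V W W' : Type*} [NormedAddCommGroup V] [NormedSpace ℝ V]
  [NormedAddCommGroup W] [NormedSpace ℝ W] [NormedAddCommGroup W'] [NormedSpace ℝ W']

/-- Continuity of the derivatives. The normalisation `1 ≤ A` lets the bound be replaced by its
powers, the form in which the chain rule estimate wants it. -/
theorem ContDiffAt.exists_iteratedFDeriv_bound {a : V → W} {x₁ : V} (ha : ContDiffAt ℝ ∞ a x₁)
    (m : ℕ) : ∃ s ∈ 𝓝 x₁, IsOpen s ∧ ContDiffOn ℝ m a s ∧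
      ∃ A : ℝ, 1 ≤ A ∧ ∀ x ∈ s, ∀ j ≤ m, ‖iteratedFDeriv ℝ j a x‖ ≤ A := by
  obtain ⟨u, hu, hau⟩ := (ha.of_le (m := m) (by exact_mod_cast le_top)).contDiffOn' le_rfl (by simp)
  simp only [insert_eq_of_mem (mem_univ x₁), univ_inter] at hau
  have hb : ∀ j ∈ Finset.range (m + 1), ∀ᶠ x in 𝓝 x₁, ‖iteratedFDeriv ℝ j a x‖ <
      ‖iteratedFDeriv ℝ j a x₁‖ + 1 := by
    intro j hj
    have hjm : j ≤ m := by simpa [Nat.lt_succ_iff] using hj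
    have hc : ContinuousAt (iteratedFDeriv ℝ j a) x₁ := by
      have := (hau.2.continuousOn_iteratedFDerivWithin (m := j) (by exact_mod_cast hjm)
        hu.uniqueDiffOn).congr fun x hx => (iteratedFDerivWithin_of_isOpen j hu hx).symm
      exact this.continuousAt (hu.mem_nhds hau.1)
    exact hc.norm.eventually_lt_const (by linarith)
  have hb' := (Filter.eventually_all_finset _).2 hb
  obtain ⟨t, ht, hto, hxt⟩ := eventually_nhds_iff.1 hb'
  refine ⟨t ∩ u, (hto.inter hu).mem_nhds ⟨hxt, hau.1⟩, hto.inter hu, hau.2.mono inter_subset_right,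
    1 + ∑ j ∈ Finset.range (m + 1), (‖iteratedFDeriv ℝ j a x₁‖ + 1), ?_, ?_⟩
  · have : 0 ≤ ∑ j ∈ Finset.range (m + 1), (‖iteratedFDeriv ℝ j a x₁‖ + 1) := by positivity
    linarith
  · intro x hx j hj
    have hj' : j ∈ Finset.range (m + 1) := by simpa [Nat.lt_succ_iff] using hj
    have h1 := (ht x hx.1 j hj').le
    have h2 := Finset.single_le_sum (f := fun j => ‖iteratedFDeriv ℝ j a x₁‖ + 1)
      (fun i _ => by positivity) hj'
    linarith

/-- Multiplication by a smooth operator-valued function and composition with a smooth map is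
locally bounded for the `C^m` norms. -/
theorem exists_bound_clm_apply_comp {U : Set V} (hU : IsOpen U) {ψ : V → V} {x₁ : V}
    (hψ : ContDiffAt ℝ ∞ ψ x₁) (hx₁ : ψ x₁ ∈ U) {a : V → W →L[ℝ] W'} (ha : ContDiffAt ℝ ∞ a x₁)
    (m : ℕ) : ∃ s ∈ 𝓝 x₁, IsOpen s ∧ ∃ A : ℝ, 0 ≤ A ∧ ∀ u : V → W, ContDiffOn ℝ m u U →
      ContDiffOn ℝ m (fun y => a y (u (ψ y))) s ∧
      ∀ c : ℝ, 0 ≤ c → (∀ x ∈ U, ∀ j ≤ m, ‖iteratedFDeriv ℝ j u x‖ ≤ c) →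
        ∀ x ∈ s, ∀ j ≤ m, ‖iteratedFDeriv ℝ j (fun y => a y (u (ψ y))) x‖ ≤ A * c := by
  obtain ⟨s₁, hs₁, hs₁o, has, A, hA, hAb⟩ := ContDiffAt.exists_iteratedFDeriv_bound ha m
  obtain ⟨s₂, hs₂, hs₂o, hps, D, hD, hDb⟩ := ContDiffAt.exists_iteratedFDeriv_bound hψ m
  have hpo : IsOpen (s₂ ∩ ψ ⁻¹' U) := hps.continuousOn.isOpen_inter_preimage hs₂o hU
  set s := s₁ ∩ (s₂ ∩ ψ ⁻¹' U) with hs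
  have hso : IsOpen s := hs₁o.inter hpo
  have hxs : x₁ ∈ s := ⟨mem_of_mem_nhds hs₁, mem_of_mem_nhds hs₂, hx₁⟩
  -- The Leibniz rule combined with the bound for derivatives of a composition; the constant
  -- involves `a`, `ψ` and `m` but not `u`.
  refine ⟨s, hso.mem_nhds hxs, hso,
    ∑ j ∈ Finset.range (m + 1), ∑ i ∈ Finset.range (j + 1),
      (j.choose i : ℝ) * A * ((j - i).factorial * D ^ (j - i)), by positivity, fun u hu => ?_⟩
  have hcomp : ContDiffOn ℝ m (u ∘ ψ) s :=
    hu.comp (hps.mono fun x hx => hx.2.1) fun x hx => hx.2.2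
  have has' : ContDiffOn ℝ m a s := has.mono fun x hx => hx.1
  refine ⟨has'.clm_apply hcomp, fun c hc hb x hx j hj => ?_⟩
  have hjm : ((j : ℕ) : WithTop ℕ∞) ≤ m := by exact_mod_cast hj
  rw [← iteratedFDerivWithin_of_isOpen j hso hx]
  refine (norm_iteratedFDerivWithin_clm_apply has' hcomp hso.uniqueDiffOn hx hjm).trans ?_
  have hj' : j ∈ Finset.range (m + 1) := by simpa [Nat.lt_succ_iff] using hj
  have hle := Finset.single_le_sum (f := fun j => ∑ i ∈ Finset.range (j + 1),
    (j.choose i : ℝ) * A * ((j - i).factorial * D ^ (j - i))) (fun i _ => by positivity) hj'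
  refine le_trans ?_ (mul_le_mul_of_nonneg_right hle hc)
  rw [Finset.sum_mul]
  refine Finset.sum_le_sum fun i hi => ?_
  have hij : i ≤ j := by simpa [Nat.lt_succ_iff] using hi
  have h1 : ‖iteratedFDerivWithin ℝ i a s x‖ ≤ A := by
    rw [iteratedFDerivWithin_of_isOpen i hso hx]
    exact hAb x hx.1 i (hij.trans hj)
  have h2 : ‖iteratedFDerivWithin ℝ (j - i) (u ∘ ψ) s x‖ ≤ (j - i).factorial * c * D ^ (j - i) := by
    refine norm_iteratedFDerivWithin_comp_le hu (hps.mono fun x hx => hx.2.1)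
      (by exact_mod_cast (Nat.sub_le j i).trans hj) hU.uniqueDiffOn hso.uniqueDiffOn
      (fun x hx => hx.2.2) hx (fun k hk => ?_) (fun k hk1 hk => ?_)
    · rw [iteratedFDerivWithin_of_isOpen k hU hx.2.2]
      exact hb _ hx.2.2 k (hk.trans ((Nat.sub_le j i).trans hj))
    · rw [iteratedFDerivWithin_of_isOpen k hso hx]
      exact (hDb x hx.2.1 k (hk.trans ((Nat.sub_le j i).trans hj))).trans
        (le_self_pow₀ hD (by omega))
  calc (j.choose i : ℝ) * ‖iteratedFDerivWithin ℝ i a s x‖ *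
        ‖iteratedFDerivWithin ℝ (j - i) (fun y => u (ψ y)) s x‖
      ≤ (j.choose i : ℝ) * A * ((j - i).factorial * c * D ^ (j - i)) := by gcongr; exact h2
    _ = _ := by ring

/-- Smooth interpolation of a sequence. -/
def interp {W : Type*} [AddCommGroup W] [Module ℝ W] (w : ℕ → W) (t : ℝ) : W :=
  w ⌊t⌋₊ + Real.smoothTransition (t - ⌊t⌋₊) • (w (⌊t⌋₊ + 1) - w ⌊t⌋₊)

theorem interp_eq_convexCombo {W : Type*} [AddCommGroup W] [Module ℝ W] (w : ℕ → W) (t : ℝ) :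
    interp w t = (1 - Real.smoothTransition (t - ⌊t⌋₊)) • w ⌊t⌋₊ +
      Real.smoothTransition (t - ⌊t⌋₊) • w (⌊t⌋₊ + 1) := by
  rw [interp]; module

/-- The floor disappears by telescoping: below `⌊t⌋₊` the transition function is `1`, above it is
`0`. On `[0, N)` this is a fixed finite sum, which shows smoothness across integers. -/
theorem interp_eq_sum {W : Type*} [AddCommGroup W] [Module ℝ W] (w : ℕ → W) {t : ℝ} (ht : 0 ≤ t) {N : ℕ} (hN : t < N) :
    interp w t = w 0 + ∑ k ∈ Finset.range N, Real.smoothTransition (t - k) • (w (k + 1) - w k) := by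
  have hm : ⌊t⌋₊ < N := (Nat.floor_lt ht).2 hN
  obtain ⟨d, rfl⟩ : ∃ d, N = ⌊t⌋₊ + 1 + d := ⟨N - (⌊t⌋₊ + 1), by omega⟩
  have hfl : (⌊t⌋₊ : ℝ) ≤ t := Nat.floor_le ht
  have hfl' : t < ⌊t⌋₊ + 1 := Nat.lt_floor_add_one t
  rw [Finset.sum_range_add, Finset.sum_range_succ, interp]
  have h1 : ∑ k ∈ Finset.range ⌊t⌋₊, Real.smoothTransition (t - k) • (w (k + 1) - w k) =
      w ⌊t⌋₊ - w 0 := by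
    rw [← Finset.sum_range_sub]
    refine Finset.sum_congr rfl fun k hk => ?_
    have hk' : (k : ℝ) + 1 ≤ ⌊t⌋₊ := by exact_mod_cast Finset.mem_range.1 hk
    rw [Real.smoothTransition.one_of_one_le (by linarith), one_smul]
  have h2 : ∑ k ∈ Finset.range d, Real.smoothTransition (t - (⌊t⌋₊ + 1 + k : ℕ)) •
      (w (⌊t⌋₊ + 1 + k + 1) - w (⌊t⌋₊ + 1 + k)) = 0 := by
    refine Finset.sum_eq_zero fun k _ => ?_
    rw [Real.smoothTransition.zero_of_nonpos, zero_smul]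
    push_cast
    have : (0 : ℝ) ≤ k := Nat.cast_nonneg k
    linarith
  rw [h1, h2]
  module

theorem contDiffOn_interp {U : Set V} {F : ℕ → V → W} (hF : ∀ k, ContDiffOn ℝ ∞ (F k) U) :
    ContDiffOn ℝ ∞ (fun q : ℝ × V => interp (fun k => F k q.2) (1 / q.1)) (Ioi 0 ×ˢ U) := by
  rintro ⟨ε, x⟩ ⟨hε, hx⟩
  have hε : 0 < ε := hε
  obtain ⟨N, hN⟩ := exists_nat_gt (1 / ε)
  have hev : ∀ᶠ q : ℝ × V in 𝓝[Ioi 0 ×ˢ U] (ε, x), interp (fun k => F k q.2) (1 / q.1) =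
      F 0 q.2 + ∑ k ∈ Finset.range N, Real.smoothTransition (1 / q.1 - k) •
        (F (k + 1) q.2 - F k q.2) := by
    have hc : ContinuousAt (fun q : ℝ × V => 1 / q.1) (ε, x) :=
      continuousAt_const.div continuousAt_fst hε.ne'
    filter_upwards [self_mem_nhdsWithin, nhdsWithin_le_nhds (hc.eventually_lt_const hN)]
      with q hq hqN
    exact interp_eq_sum _ (one_div_nonneg.2 (le_of_lt hq.1)) hqN
  refine ContDiffWithinAt.congr_of_eventuallyEq ?_ hev (hev.self_of_nhdsWithin ⟨hε, hx⟩)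
  have hF' : ∀ k, ContDiffWithinAt ℝ ∞ (fun q : ℝ × V => F k q.2) (Ioi 0 ×ˢ U) (ε, x) := fun k =>
    (hF k x hx).comp (ε, x) contDiffWithinAt_snd fun q hq => hq.2
  refine (hF' 0).add (ContDiffWithinAt.sum fun k _ => ContDiffWithinAt.smul ?_
    ((hF' (k + 1)).sub (hF' k)))
  refine Real.smoothTransition.contDiffAt.comp_contDiffWithinAt (ε, x) ?_
  exact (contDiffWithinAt_const.div contDiffWithinAt_fst hε.ne').sub contDiffWithinAt_const

theorem interp_mem {W : Type*} [AddCommGroup W] [Module ℝ W] {w : ℕ → W} {t : ℝ} {S : Set W} (hS : Convex ℝ S)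
    (h0 : w ⌊t⌋₊ ∈ S) (h1 : w (⌊t⌋₊ + 1) ∈ S) : interp w t ∈ S := by
  rw [interp_eq_convexCombo]
  exact hS h0 h1 (sub_nonneg.2 (Real.smoothTransition.le_one _)) (Real.smoothTransition.nonneg _)
    (by ring)

end Estimates

/-! ### Linear algebra of Lorentzian forms and the convex condition -/

section Fibre

variable {V V' : Type*} [TopologicalSpace V] [AddCommGroup V] [Module ℝ V]
  [TopologicalSpace V'] [AddCommGroup V'] [Module ℝ V']

/-- Symmetric bilinear forms of signature `(-,+,…,+)`. -/
def LorentzForm (b : V →L[ℝ] V →L[ℝ] ℝ) : Prop :=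
  (∀ X Y : V, b X Y = b Y X) ∧ ∃ v : V, b v v < 0 ∧ ∀ w : V, w ≠ 0 → b v w = 0 → 0 < b w w

/-- The forms `b` and `g` differ by at most `r` in the norm defined by `h`. -/
def CloseForm (h : V →L[ℝ] V →L[ℝ] ℝ) (r : ℝ) (b g : V →L[ℝ] V →L[ℝ] ℝ) : Prop :=
  ∀ X Y : V, |b X Y - g X Y| ≤ r * (√(h X X) * √(h Y Y))

/-- For `σ = -1` the causal cone of `g` lies in the open cone of `b`, for `σ = 1` the causal cone
of `b` lies in the open cone of `g`. -/
def ConeForm (σ : ℝ) (b g : V →L[ℝ] V →L[ℝ] ℝ) : Prop :=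
  ∀ X : V, X ≠ 0 → 0 ≤ σ * g X X → 0 < σ * b X X

/-- `b` is a Lorentzian form `ε / 3`-close to `g` with larger (`σ = -1`) or smaller (`σ = 1`)
cone, for a reason that is convex in `b`. -/
def GoodForm (σ ε : ℝ) (g h b : V →L[ℝ] V →L[ℝ] ℝ) : Prop :=
  (∀ X Y : V, b X Y = b Y X) ∧ ConeForm σ b g ∧
    ∃ r, r ≤ ε / 3 ∧
      (∀ b' : V →L[ℝ] V →L[ℝ] ℝ, (∀ X Y : V, b' X Y = b' Y X) → CloseForm h r b' g →
        LorentzForm b') ∧ CloseForm h r b g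

theorem CloseForm.mono {h : V →L[ℝ] V →L[ℝ] ℝ} {r r' : ℝ} {b g : V →L[ℝ] V →L[ℝ] ℝ}
    (hb : CloseForm h r b g) (hr : r ≤ r') : CloseForm h r' b g := fun X Y =>
  (hb X Y).trans (mul_le_mul_of_nonneg_right hr (by positivity))

theorem GoodForm.lorentzForm {σ ε : ℝ} {g h b : V →L[ℝ] V →L[ℝ] ℝ} (hb : GoodForm σ ε g h b) :
    LorentzForm b := by
  obtain ⟨hs, -, r, -, hL, hc⟩ := hb
  exact hL b hs hc

theorem GoodForm.closeForm {σ ε : ℝ} {g h b : V →L[ℝ] V →L[ℝ] ℝ} (hb : GoodForm σ ε g h b) :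
    CloseForm h (ε / 3) b g := by
  obtain ⟨-, -, r, hr, -, hc⟩ := hb
  exact hc.mono hr

/-- The two radii may differ, but the larger one works for both forms, and at that radius closeness
to `g` is convex and still forces Lorentzian signature. -/
theorem convex_goodForm (σ ε : ℝ) (g h : V →L[ℝ] V →L[ℝ] ℝ) :
    Convex ℝ {b | GoodForm σ ε g h b} := by
  rintro b₁ ⟨hs₁, hc₁, r₁, hr₁, hL₁, hb₁⟩ b₂ ⟨hs₂, hc₂, r₂, hr₂, hL₂, hb₂⟩ s t hs ht hst
  have happ : ∀ X Y : V, (s • b₁ + t • b₂) X Y = s * b₁ X Y + t * b₂ X Y := fun X Y => by simp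
  refine ⟨fun X Y => by rw [happ, happ, hs₁, hs₂], fun X hX hg => ?_, max r₁ r₂, max_le hr₁ hr₂,
    ?_, fun X Y => ?_⟩
  · rw [happ]
    have h1 := hc₁ X hX hg
    have h2 := hc₂ X hX hg
    have : σ * (s * b₁ X X + t * b₂ X X) = s * (σ * b₁ X X) + t * (σ * b₂ X X) := by ring
    rw [this]
    rcases hs.eq_or_lt with rfl | hs'
    · have : t = 1 := by linarith
      subst this; simpa using h2
    · have := mul_pos hs' h1
      have := mul_nonneg ht h2.le
      linarith
  · rcases max_choice r₁ r₂ with h | h <;> rw [h] <;> assumption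
  · rw [happ]
    have h1 := hb₁.mono (le_max_left r₁ r₂) X Y
    have h2 := hb₂.mono (le_max_right r₁ r₂) X Y
    have : s * b₁ X Y + t * b₂ X Y - g X Y = s * (b₁ X Y - g X Y) + t * (b₂ X Y - g X Y) := by
      linear_combination (g X Y) * hst
    rw [this]
    refine (abs_add_le _ _).trans ?_
    rw [abs_mul, abs_mul, abs_of_nonneg hs, abs_of_nonneg ht]
    have h3 := mul_le_mul_of_nonneg_left h1 hs
    have h4 := mul_le_mul_of_nonneg_left h2 ht
    calc _ ≤ s * (max r₁ r₂ * (√(h X X) * √(h Y Y))) + t * (max r₁ r₂ * (√(h X X) * √(h Y Y))) :=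
          add_le_add h3 h4
      _ = (s + t) * (max r₁ r₂ * (√(h X X) * √(h Y Y))) := by ring
      _ = _ := by rw [hst, one_mul]

/-- The pullback of a bilinear form under a linear map. -/
def pull (b : V' →L[ℝ] V' →L[ℝ] ℝ) (A : V →L[ℝ] V') : V →L[ℝ] V →L[ℝ] ℝ :=
  (ContinuousLinearMap.precomp ℝ A).comp (b.comp A)

@[simp]
theorem pull_apply (b : V' →L[ℝ] V' →L[ℝ] ℝ) (A : V →L[ℝ] V') (X Y : V) :
    pull b A X Y = b (A X) (A Y) := rfl

/-- Good forms pull back to good forms under linear isomorphisms. -/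
theorem goodForm_pull {σ ε : ℝ} {g h b : V' →L[ℝ] V' →L[ℝ] ℝ} (hb : GoodForm σ ε g h b)
    (A : V →L[ℝ] V') (B : V' →L[ℝ] V) (hBA : ∀ v, B (A v) = v) (hAB : ∀ v, A (B v) = v) :
    GoodForm σ ε (pull g A) (pull h A) (pull b A) := by
  obtain ⟨hs, hc, r, hr, hL, hb⟩ := hb
  refine ⟨fun X Y => hs _ _, fun X hX hg => hc (A X) (fun h0 => hX ?_) hg, r, hr,
    fun b' hb' hcl => ?_, fun X Y => hb _ _⟩
  · rw [← hBA X, h0, map_zero]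
  · obtain ⟨-, v, hv, hvw⟩ := hL (pull b' B) (fun X Y => hb' _ _) fun X Y => by
      have := hcl (B X) (B Y)
      simpa [hAB] using this
    refine ⟨hb', B v, hv, fun w hw hvw' => ?_⟩
    have := hvw (A w) (fun h0 => hw (by rw [← hBA w, h0, map_zero])) (by simpa [hBA] using hvw')
    simpa [hBA] using this

/-- A form negative at `T` and positive up to a multiple of `θ ⊗ θ` is Lorentzian. -/
theorem lorentzForm_of_pos {b : V →L[ℝ] V →L[ℝ] ℝ} (hb : ∀ X Y, b X Y = b Y X) {T : V}
    (hT : b T T < 0) {θ : V →L[ℝ] ℝ} {K : ℝ} (hK : ∀ w ≠ 0, 0 < b w w + K * θ w ^ 2) :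
    LorentzForm b := by
  refine ⟨hb, T, hT, fun w hw hTw => ?_⟩
  have hT0 : T ≠ 0 := fun h => by simp [h] at hT
  -- Hence `w` splits along `T` and `ker θ`; on `ker θ` the form `b` is positive, and `b T w = 0`
  -- turns the `T`-part into `-α ^ 2 * b T T`.
  have hθT : θ T ≠ 0 := fun h => by
    have := hK T hT0
    rw [h] at this; simp at this; linarith
  set α := θ w / θ T with hα
  set u := w - α • T with hu
  have hθu : θ u = 0 := by simp [hu, hα, hθT]
  have hwu : w = α • T + u := by rw [hu]; abel
  have e1 : b T w = α * b T T + b T u := by rw [hwu]; simp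
  have e2 : b w w = α ^ 2 * b T T + 2 * α * b T u + b u u := by
    rw [hwu]; simp [hb u T]; ring
  have e3 : b w w = -α ^ 2 * b T T + b u u := by
    rw [e2]; rw [e1] at hTw; linear_combination 2 * α * hTw
  by_cases hu0 : u = 0
  · have : α ≠ 0 := fun h => hw (by rw [hwu, h, hu0]; simp)
    rw [e3, hu0]
    have : 0 < α ^ 2 := by positivity
    simp only [map_zero, add_zero]
    nlinarith
  · have := hK u hu0
    rw [hθu] at this
    rw [e3]
    nlinarith [sq_nonneg α]

end Fibre

/-! ### Quantitative cone perturbation near a Lorentzian form -/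

section FibreNormed

variable {V : Type*} [NormedAddCommGroup V] [NormedSpace ℝ V] [FiniteDimensional ℝ V]

theorem exists_pos_mul_norm_sq_le {b : V →L[ℝ] V →L[ℝ] ℝ} (hb : ∀ w ≠ 0, 0 < b w w) :
    ∃ c > 0, ∀ w, c * ‖w‖ ^ 2 ≤ b w w := by
  have hcont : Continuous fun w => b w w := by fun_prop
  rcases (Metric.sphere (0 : V) 1).eq_empty_or_nonempty with he | hne
  · refine ⟨1, one_pos, fun w => ?_⟩
    by_cases hw : w = 0
    · simp [hw]
    · have : ‖w‖⁻¹ • w ∈ Metric.sphere (0 : V) 1 := by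
        simp [norm_smul, hw]
      rw [he] at this
      exact absurd this (notMem_empty _)
  · obtain ⟨v, hv, hmin⟩ := (isCompact_sphere (0 : V) 1).exists_isMinOn hne hcont.continuousOn
    have hv1 : ‖v‖ = 1 := by simpa using hv
    refine ⟨b v v, hb v fun h => by simp [h] at hv1, fun w => ?_⟩
    by_cases hw : w = 0
    · simp [hw]
    · have hw' : ‖w‖ ≠ 0 := norm_ne_zero_iff.2 hw
      have hmem : ‖w‖⁻¹ • w ∈ Metric.sphere (0 : V) 1 := by
        simp [norm_smul, hw]
      have := hmin hmem
      simp only [mem_ofPred_eq, map_smul, smul_apply, smul_eq_mul] at this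
      calc b v v * ‖w‖ ^ 2 ≤ (‖w‖⁻¹ * (‖w‖⁻¹ * b w w)) * ‖w‖ ^ 2 := by gcongr
        _ = b w w := by field_simp

theorem LorentzForm.exists_pos_bound {g : V →L[ℝ] V →L[ℝ] ℝ} (hg : LorentzForm g) :
    ∃ (T : V) (θ : V →L[ℝ] ℝ) (K c : ℝ), g T T < 0 ∧ 0 < K ∧ 0 < c ∧
      ∀ w, c * ‖w‖ ^ 2 ≤ g w w + K * θ w ^ 2 := by
  obtain ⟨hs, T, hT, hpos⟩ := hg
  have hTne : g T T ≠ 0 := hT.ne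
  -- With this factor the correction is `-2 * g T T` on `T`, so the sign of the form on `ℝ T` is
  -- reversed while the orthogonal complement is untouched. Compactness of the sphere then gives
  -- `c`.
  set K : ℝ := 2 / (-g T T) with hK
  have hKpos : 0 < K := by
    have : 0 < -g T T := by linarith
    positivity
  have hKT : K * g T T = -2 := by
    rw [hK, div_mul_eq_mul_div, div_neg, mul_div_cancel_right₀ _ hTne]
  have key : ∀ w ≠ 0, 0 < (g + K • (g T).smulRight (g T)) w w := by
    intro w hw
    set α := g T w / g T T with hα
    set u := w - α • T with hu
    have hTu : g T u = 0 := by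
      simp [hu, hα, div_mul_cancel₀ _ hTne]
    have hwu : w = α • T + u := by rw [hu]; abel
    have e1 : g T w = α * g T T := by rw [hα, div_mul_cancel₀ _ hTne]
    have e2 : g w w = α ^ 2 * g T T + g u u := by
      rw [hwu]; simp [hs u T, hTu]; ring
    have e3 : (g + K • (g T).smulRight (g T)) w w = -α ^ 2 * g T T + g u u := by
      simp only [add_apply, smul_apply,
        ContinuousLinearMap.smulRight_apply, smul_eq_mul]
      rw [e2, e1]
      linear_combination α ^ 2 * g T T * hKT
    rw [e3]
    by_cases hu0 : u = 0
    · have : α ≠ 0 := fun h => hw (by rw [hwu, h, hu0]; simp)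
      have : 0 < α ^ 2 := by positivity
      simp only [hu0, map_zero, add_zero]
      nlinarith
    · have := hpos u hu0 hTu
      nlinarith [sq_nonneg α]
  obtain ⟨c, hc, hcb⟩ := exists_pos_mul_norm_sq_le key
  refine ⟨T, g T, K, c, hT, hKpos, hc, fun w => (hcb w).trans (le_of_eq ?_)⟩
  simp [sq]

set_option maxHeartbeats 1000000 in
/-- Near a Lorentzian form `g₀`, adding a small multiple of a fixed `σ θ ⊗ θ` and a much smaller
perturbation gives good forms. -/
theorem exists_goodForm_nhds {σ : ℝ} (hσ : σ = 1 ∨ σ = -1) {g₀ h₀ : V →L[ℝ] V →L[ℝ] ℝ}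
    (hg₀ : LorentzForm g₀) (hh₀ : ∀ w ≠ 0, 0 < h₀ w w) :
    ∃ (θ : V →L[ℝ] ℝ) (κ Λ ν : ℝ), 0 < κ ∧ 0 < Λ ∧ 0 < ν ∧
      ∀ (g h b : V →L[ℝ] V →L[ℝ] ℝ) (lam ε : ℝ), ‖g - g₀‖ ≤ ν → ‖h - h₀‖ ≤ ν → 0 < lam →
        lam ≤ Λ → lam ≤ Λ * ε → (∀ X Y, b X Y = b Y X) →
        ‖b - (g + (σ * lam) • θ.smulRight θ)‖ ≤ κ * lam → GoodForm σ ε g h b := by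
  obtain ⟨T, θ, K, c, hT, hK, hc, hbound⟩ := hg₀.exists_pos_bound
  obtain ⟨m, hm, hmb⟩ := exists_pos_mul_norm_sq_le hh₀
  have hT0 : T ≠ 0 := fun h => by simp [h] at hT
  have hTn : 0 < ‖T‖ ^ 2 := by positivity
  -- After multiplication by `K`, the error uses half of the margin `c / 2` left for nearby `g`.
  set κ := c / (4 * K) with hκ
  have hκpos : 0 < κ := by positivity
  have hκK : K * κ = c / 4 := by rw [hκ]; field_simp
  set q := κ + ‖θ‖ ^ 2 with hq
  have hqpos : 0 < q := by positivity
  -- Half of each margin survives for `g` and `h` this near: positivity of `g + K θ ⊗ θ`, positivity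
  -- of `h`, negativity of `g T T`.
  set ν := min (c / 2) (min (m / 2) (-g₀ T T / (2 * ‖T‖ ^ 2))) with hν
  have hνpos : 0 < ν := by
    have : 0 < -g₀ T T := by linarith
    positivity
  have hν1 : ν ≤ c / 2 := min_le_left _ _
  have hν2 : ν ≤ m / 2 := (min_le_right _ _).trans (min_le_left _ _)
  have hν3 : ν * ‖T‖ ^ 2 ≤ -g₀ T T / 2 := by
    have : ν ≤ -g₀ T T / (2 * ‖T‖ ^ 2) := (min_le_right _ _).trans (min_le_right _ _)
    calc ν * ‖T‖ ^ 2 ≤ -g₀ T T / (2 * ‖T‖ ^ 2) * ‖T‖ ^ 2 := by gcongr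
      _ = _ := by field_simp
  set S := ‖h₀‖ + ν with hS
  have hSpos : 0 < S := by positivity
  -- `b - g` has norm at most `lam * q`; dividing by the lower bound `m / 2` of `h` gives the radius
  -- `lam * Q` measured by `h`.
  set Q := q / (m / 2) with hQ
  have hQpos : 0 < Q := by positivity
  -- In order: the cone estimate needs `lam ≤ K`; the radius must be at most `ε / 3`; forms within
  -- the radius must stay positive up to `K θ ⊗ θ`; they must stay negative at `T`.
  set Λ := min K (min (1 / (3 * Q)) (min (c / (4 * (Q * S))) (-g₀ T T / (4 * (Q * S * ‖T‖ ^ 2)))))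
    with hΛ
  have hΛpos : 0 < Λ := by
    have : 0 < -g₀ T T := by linarith
    positivity
  have hΛ1 : Λ ≤ K := min_le_left _ _
  have hΛ2 : Λ * Q ≤ 1 / 3 := by
    have : Λ ≤ 1 / (3 * Q) := (min_le_right _ _).trans (min_le_left _ _)
    calc Λ * Q ≤ 1 / (3 * Q) * Q := by gcongr
      _ = _ := by field_simp
  have hΛ3 : Λ * Q * S ≤ c / 4 := by
    have : Λ ≤ c / (4 * (Q * S)) :=
      (min_le_right _ _).trans ((min_le_right _ _).trans (min_le_left _ _))
    calc Λ * Q * S ≤ c / (4 * (Q * S)) * Q * S := by gcongr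
      _ = _ := by field_simp
  have hΛ4 : Λ * Q * S * ‖T‖ ^ 2 ≤ -g₀ T T / 4 := by
    have : Λ ≤ -g₀ T T / (4 * (Q * S * ‖T‖ ^ 2)) :=
      (min_le_right _ _).trans ((min_le_right _ _).trans (min_le_right _ _))
    calc Λ * Q * S * ‖T‖ ^ 2 ≤ -g₀ T T / (4 * (Q * S * ‖T‖ ^ 2)) * Q * S * ‖T‖ ^ 2 := by gcongr
      _ = _ := by field_simp
  refine ⟨θ, κ, Λ, ν, hκpos, hΛpos, hνpos, fun g h b lam ε hg hh hl hlΛ hlε hbs hb => ?_⟩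
  have hquad : ∀ (b : V →L[ℝ] V →L[ℝ] ℝ) (C : ℝ), ‖b‖ ≤ C → ∀ X Y, |b X Y| ≤ C * ‖X‖ * ‖Y‖ :=
    fun b C hC X Y => (b.le_opNorm₂ X Y).trans (by gcongr)
  have hgX : ∀ X Y, |g X Y - g₀ X Y| ≤ ν * ‖X‖ * ‖Y‖ := fun X Y => by simpa using hquad _ _ hg X Y
  have hhX : ∀ X Y, |h X Y - h₀ X Y| ≤ ν * ‖X‖ * ‖Y‖ := fun X Y => by simpa using hquad _ _ hh X Y
  have hbX : ∀ X Y, |b X Y - (g X Y + σ * lam * (θ X * θ Y))| ≤ κ * lam * ‖X‖ * ‖Y‖ := fun X Y => by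
    simpa [mul_assoc] using hquad _ _ hb X Y
  have hpos : ∀ w, c / 2 * ‖w‖ ^ 2 ≤ g w w + K * θ w ^ 2 := fun w => by
    have h1 := abs_le.1 (hgX w w)
    have h2 := hbound w
    nlinarith [sq_nonneg ‖w‖]
  have hgT : g T T ≤ g₀ T T / 2 := by
    have h1 := (abs_le.1 (hgX T T)).2
    nlinarith
  have hhlow : ∀ w, m / 2 * ‖w‖ ^ 2 ≤ h w w := fun w => by
    have h1 := abs_le.1 (hhX w w)
    have h2 := hmb w
    nlinarith [sq_nonneg ‖w‖]
  have hhup : ∀ w, h w w ≤ S * ‖w‖ ^ 2 := fun w => by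
    have h1 := abs_le.1 (hhX w w)
    have h2 := (le_abs_self _).trans (hquad h₀ _ le_rfl w w)
    rw [hS]
    nlinarith
  have hsq1 : ∀ X Y, m / 2 * (‖X‖ * ‖Y‖) ≤ √(h X X) * √(h Y Y) := fun X Y => by
    rw [← Real.sqrt_mul ((by positivity : 0 ≤ m / 2 * ‖X‖ ^ 2).trans (hhlow X))]
    refine Real.le_sqrt_of_sq_le ?_
    calc (m / 2 * (‖X‖ * ‖Y‖)) ^ 2 = (m / 2 * ‖X‖ ^ 2) * (m / 2 * ‖Y‖ ^ 2) := by ring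
      _ ≤ h X X * h Y Y := mul_le_mul (hhlow X) (hhlow Y) (by positivity)
          ((by positivity : 0 ≤ m / 2 * ‖X‖ ^ 2).trans (hhlow X))
  have hsq2 : ∀ X, √(h X X) * √(h X X) ≤ S * ‖X‖ ^ 2 := fun X => by
    rw [Real.mul_self_sqrt ((by positivity : 0 ≤ m / 2 * ‖X‖ ^ 2).trans (hhlow X))]
    exact hhup X
  refine ⟨hbs, fun X hX hgσ => ?_, lam * Q, ?_, fun b' hb's hb' => ?_, fun X Y => ?_⟩
  · have hXn : 0 < ‖X‖ ^ 2 := by positivity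
    have h1 := abs_le.1 (hbX X X)
    have h2 := hpos X
    have h3 : lam * (c / 2 * ‖X‖ ^ 2) ≤ lam * (g X X + K * θ X ^ 2) := by gcongr
    have h4 : K * (κ * lam * ‖X‖ * ‖X‖) = lam * (c / 4 * ‖X‖ ^ 2) := by
      linear_combination lam * ‖X‖ ^ 2 * hκK
    have h5 : 0 < lam * (c / 4 * ‖X‖ ^ 2) := by positivity
    rcases hσ with rfl | rfl
    · have h6 : lam * g X X ≤ K * g X X := by
        have : 0 ≤ g X X := by linarith
        gcongr
        exact hlΛ.trans hΛ1
      have h7 := mul_le_mul_of_nonneg_left h1.1 hK.le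
      have : 0 < K * b X X := by nlinarith
      simpa using (mul_pos_iff_of_pos_left hK).1 this
    · have h6 : lam * g X X ≤ 0 := mul_nonpos_of_nonneg_of_nonpos hl.le (by linarith)
      have h7 := mul_le_mul_of_nonneg_left h1.2 hK.le
      have h8 : K * g X X ≤ 0 := mul_nonpos_of_nonneg_of_nonpos hK.le (by linarith)
      have : 0 < K * (-1 * b X X) := by nlinarith
      exact (mul_pos_iff_of_pos_left hK).1 this
  · have hε : 0 ≤ ε := by
      by_contra hε
      have := mul_neg_of_pos_of_neg hΛpos (not_le.1 hε)
      linarith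
    calc lam * Q ≤ Λ * ε * Q := by gcongr
      _ = (Λ * Q) * ε := by ring
      _ ≤ 1 / 3 * ε := by gcongr
      _ = ε / 3 := by ring
  · have hdiff : ∀ X, |b' X X - g X X| ≤ Λ * Q * S * ‖X‖ ^ 2 := fun X => by
      calc |b' X X - g X X| ≤ lam * Q * (√(h X X) * √(h X X)) := hb' X X
        _ ≤ Λ * Q * (S * ‖X‖ ^ 2) :=
          mul_le_mul (mul_le_mul_of_nonneg_right hlΛ hQpos.le) (hsq2 X) (by positivity)
            (by positivity)
        _ = _ := by ring
    refine lorentzForm_of_pos hb's (T := T) ?_ (θ := θ) (K := K) fun w hw => ?_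
    · have := (abs_le.1 (hdiff T)).2
      linarith
    · have h1 := (abs_le.1 (hdiff w)).1
      have h2 := hpos w
      have hwn : 0 < ‖w‖ ^ 2 := by positivity
      have h3 : Λ * Q * S * ‖w‖ ^ 2 ≤ c / 4 * ‖w‖ ^ 2 := by gcongr
      have h4 : 0 < c / 4 * ‖w‖ ^ 2 := by positivity
      linarith
  · have hθ : |θ X * θ Y| ≤ ‖θ‖ ^ 2 * ‖X‖ * ‖Y‖ := by
      rw [abs_mul]
      calc |θ X| * |θ Y| ≤ (‖θ‖ * ‖X‖) * (‖θ‖ * ‖Y‖) := by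
            gcongr
            · exact θ.le_opNorm X
            · exact θ.le_opNorm Y
        _ = _ := by ring
    have hσ' : |σ * lam * (θ X * θ Y)| ≤ lam * (‖θ‖ ^ 2 * ‖X‖ * ‖Y‖) := by
      have : |σ| = 1 := by rcases hσ with rfl | rfl <;> simp
      rw [abs_mul, abs_mul, this, abs_of_pos hl, one_mul]
      gcongr
    calc |b X Y - g X Y| = |(b X Y - (g X Y + σ * lam * (θ X * θ Y))) + σ * lam * (θ X * θ Y)| := by
          congr 1; ring
      _ ≤ κ * lam * ‖X‖ * ‖Y‖ + lam * (‖θ‖ ^ 2 * ‖X‖ * ‖Y‖) :=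
          (abs_add_le _ _).trans (add_le_add (hbX X Y) hσ')
      _ = lam * Q * (m / 2 * (‖X‖ * ‖Y‖)) := by rw [hQ, hq]; field_simp
      _ ≤ lam * Q * (√(h X X) * √(h Y Y)) :=
          mul_le_mul_of_nonneg_left (hsq1 X Y) (by positivity)

end FibreNormed

/-! ### Local approximating families -/

section Local

open Metric

set_option maxSynthPendingDepth 3 in
-- Stated for whole functions so that `interp_mem` applies to them: for fixed `ε` the interpolated
-- function is a convex combination of two consecutive terms with constant weights.
theorem convex_C1_close_C2_bounded {V W : Type*} [NormedAddCommGroup V] [NormedSpace ℝ V]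
    [NormedAddCommGroup W] [NormedSpace ℝ W] (G : V → W) (B : Set V) (c L : ℝ) :
    Convex ℝ {u : V → W | ContDiff ℝ ∞ u ∧ ∀ x ∈ B, ‖u x - G x‖ ≤ c ∧
      ‖fderiv ℝ u x - fderiv ℝ G x‖ ≤ c ∧ ‖fderiv ℝ (fderiv ℝ u) x‖ ≤ L} := by
  rintro u ⟨hu, hub⟩ v ⟨hv, hvb⟩ s t hs ht hst
  have hd : ∀ {f : V → W}, ContDiff ℝ ∞ f → Differentiable ℝ f := fun hf =>
    hf.differentiable (by simp)
  have hdd : ∀ {f : V → W}, ContDiff ℝ ∞ f → Differentiable ℝ (fderiv ℝ f) := fun hf =>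
    (hf.fderiv_right (m := ∞) le_rfl).differentiable (by simp)
  have e1 : fderiv ℝ (s • u + t • v) = s • fderiv ℝ u + t • fderiv ℝ v := by
    ext1 x
    rw [fderiv_add ((hd hu x).const_smul s) ((hd hv x).const_smul t), fderiv_const_smul (hd hu x),
      fderiv_const_smul (hd hv x)]
    rfl
  have e2 : fderiv ℝ (fderiv ℝ (s • u + t • v)) =
      s • fderiv ℝ (fderiv ℝ u) + t • fderiv ℝ (fderiv ℝ v) := by
    rw [e1]
    ext1 x
    rw [fderiv_add ((hdd hu x).const_smul s) ((hdd hv x).const_smul t),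
      fderiv_const_smul (hdd hu x), fderiv_const_smul (hdd hv x)]
    rfl
  refine ⟨(contDiff_const.smul hu).add (contDiff_const.smul hv), fun x hx => ?_⟩
  obtain ⟨hu1, hu2, hu3⟩ := hub x hx
  obtain ⟨hv1, hv2, hv3⟩ := hvb x hx
  refine ⟨?_, ?_, ?_⟩
  · exact mem_closedBall_iff_norm.1 (convex_closedBall (G x) c (mem_closedBall_iff_norm.2 hu1)
      (mem_closedBall_iff_norm.2 hv1) hs ht hst)
  · rw [e1]
    exact mem_closedBall_iff_norm.1 (convex_closedBall _ c (mem_closedBall_iff_norm.2 hu2)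
      (mem_closedBall_iff_norm.2 hv2) hs ht hst)
  · rw [e2]
    have h4 := norm_add_le (s • fderiv ℝ (fderiv ℝ u) x) (t • fderiv ℝ (fderiv ℝ v) x)
    rw [norm_smul, norm_smul, Real.norm_of_nonneg hs, Real.norm_of_nonneg ht] at h4
    refine h4.trans ?_
    calc _ ≤ s * L + t * L := by gcongr
      _ = L := by rw [← add_mul, hst, one_mul]

variable {V W : Type*} [NormedAddCommGroup V] [NormedSpace ℝ V] [FiniteDimensional ℝ V]
  [NormedAddCommGroup W] [NormedSpace ℝ W]

/-- `G` is `C¹` on `U` with locally Lipschitz derivative. -/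
def C11On {V W : Type*} [NormedAddCommGroup V] [NormedSpace ℝ V]
    [NormedAddCommGroup W] [NormedSpace ℝ W] (G : V → W) (U : Set V) : Prop :=
  ContDiffOn ℝ 1 G U ∧ LocallyLipschitzOn U (fderiv ℝ G)

/-- The `C¹`-distance of `F ε` to `G` on `B` is at most `C * ε`, and `F ε` is bounded in `C²`. -/
def ApproxOn {V W : Type*} [NormedAddCommGroup V] [NormedSpace ℝ V]
    [NormedAddCommGroup W] [NormedSpace ℝ W] (F : ℝ → V → W) (G : V → W) (B : Set V) : Prop :=
  ∃ C, 0 ≤ C ∧ ∀ ε > 0, ∀ x ∈ B,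
    (∀ j ≤ 1, ‖iteratedFDeriv ℝ j (fun y => F ε y - G y) x‖ ≤ C * ε) ∧
    ∀ j ≤ 2, ‖iteratedFDeriv ℝ j (F ε) x‖ ≤ C

/-- A function with values in a normed space is approximated, near a point, by a smooth family of
functions whose values are convex combinations of points near `G x + lam • q`. -/
theorem exists_smooth_family [MeasurableSpace V] [BorelSpace V] [CompleteSpace W] {U : Set V}
    (hU : IsOpen U) {x₀ : V} (hx₀ : x₀ ∈ U) {G : V → W} (hG : ContinuousOn G U) {N : Set V}
    (hN : N ∈ 𝓝 x₀) (A : W →L[ℝ] W) (hA : ∀ x ∈ U, A (G x) = G x) {q : W} (hq : A q = q)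
    {κ Λ : ℝ} (hκ : 0 < κ) (hΛ : 0 < Λ) :
    ∃ r > 0, ball x₀ r ⊆ U ∩ N ∧ ∃ F : ℝ → V → W,
      ContDiffOn ℝ ∞ (fun q : ℝ × V => F q.1 q.2) (Ioi 0 ×ˢ ball x₀ r) ∧
      (∀ ε > 0, ∀ x ∈ ball x₀ r, ∀ S : Set W, Convex ℝ S → (∀ lam > 0, lam ≤ Λ → lam ≤ Λ * ε →
        ∀ b, A b = b → ‖b - (G x + lam • q)‖ ≤ κ * lam → b ∈ S) → F ε x ∈ S) ∧
      (C11On G U → ApproxOn F G (ball x₀ r)) := by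
  have hnb : ∀ᶠ x in 𝓝 x₀, (x ∈ U ∧ x ∈ N) ∧ ‖G x - G x₀‖ ≤ 1 := by
    refine ((hU.eventually_mem hx₀).and hN).and ?_
    filter_upwards [(hG.continuousAt (hU.mem_nhds hx₀)) (closedBall_mem_nhds _ one_pos)] with x hx
    exact mem_closedBall_iff_norm.1 hx
  -- The neighbourhood must be fixed before it is known whether `G` is `C^{1,1}`, hence the
  -- implication inside the existential.
  have hlip : ∃ s ∈ 𝓝 x₀, C11On G U →
      ∃ L, 0 ≤ L ∧ (∀ x ∈ s, ‖fderiv ℝ G x‖ ≤ L) ∧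
        ∀ x ∈ s, ∀ y ∈ s, ‖fderiv ℝ G x - fderiv ℝ G y‖ ≤ L * ‖x - y‖ := by
    by_cases hc : C11On G U
    · obtain ⟨K, t, ht, hK⟩ := hc.2 hx₀
      rw [hU.nhdsWithin_eq hx₀] at ht
      refine ⟨t ∩ ball x₀ 1, inter_mem ht (ball_mem_nhds _ one_pos), fun _ =>
        ⟨K + ‖fderiv ℝ G x₀‖, by positivity, fun x hx => ?_, fun x hx y hy => ?_⟩⟩
      · have h1 := hK.norm_sub_le hx.1 (mem_of_mem_nhds ht)
        have h2 : ‖x - x₀‖ ≤ 1 := (mem_ball_iff_norm.1 hx.2).le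
        have h3 : (K : ℝ) * ‖x - x₀‖ ≤ K := mul_le_of_le_one_right K.2 h2
        have h4 := norm_le_norm_sub_add (fderiv ℝ G x) (fderiv ℝ G x₀)
        linarith
      · refine (hK.norm_sub_le hx.1 hy.1).trans ?_
        gcongr
        linarith [norm_nonneg (fderiv ℝ G x₀)]
    · exact ⟨univ, univ_mem, fun h1 => absurd h1 hc⟩
  obtain ⟨s, hs, hlip⟩ := hlip
  obtain ⟨R, hR, hRs⟩ := nhds_basis_closedBall.mem_iff.1 (inter_mem hs hnb)
  set r := R / 2 with hr
  have hrpos : 0 < r := by positivity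
  have hR2 : 2 * r = R := by rw [hr]; ring
  have hsub : ball x₀ r ⊆ closedBall x₀ (2 * r) :=
    (ball_subset_ball (by linarith)).trans ball_subset_closedBall
  rw [← hR2] at hRs
  have hUs : ∀ x ∈ closedBall x₀ (2 * r), x ∈ U := fun x hx => (hRs hx).2.1.1
  -- The `k`-th term is designed for the parameter `1 / (k + 1)` and is mollified to the permitted
  -- accuracy `κ * lam k`.
  set lam : ℕ → ℝ := fun k => Λ / (k + 1) with hlam
  have hlampos : ∀ k, 0 < lam k := fun k => by positivity
  choose F' hF'1 hF'2 hF'3 hF'4 using fun k : ℕ =>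
    exists_smooth_approx x₀ hrpos (hG.mono hUs) (mul_pos hκ (hlampos k))
  set F : ℕ → V → W := fun k x => F' k x + lam k • q with hF
  have hFsm : ∀ k, ContDiff ℝ ∞ (F k) := fun k => (hF'1 k).add contDiff_const
  have hFg : ∀ ε > 0, ∀ x ∈ ball x₀ r, ∀ S : Set W, (∀ lam > 0, lam ≤ Λ → lam ≤ Λ * ε →
      ∀ b, A b = b → ‖b - (G x + lam • q)‖ ≤ κ * lam → b ∈ S) → ∀ k : ℕ, 1 / (k + 1 : ℝ) ≤ ε →
      F k x ∈ S := by
    intro ε hε x hx S hS k hk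
    refine hS (lam k) (hlampos k) ?_ ?_ _ ?_ ?_
    · exact div_le_self hΛ.le (by linarith [(Nat.cast_nonneg k : (0 : ℝ) ≤ k)])
    · calc lam k = Λ * (1 / (k + 1)) := by rw [hlam]; ring
        _ ≤ Λ * ε := by gcongr
    · rw [hF]
      simp only [map_add, map_smul, hq, hF'3 k A (fun y hy => hA y (hUs y hy)) x]
    · rw [hF, add_sub_add_right_eq_sub]
      exact hF'2 k x hx
  -- Interpolating at time `1 / ε` uses the indices `⌊1 / ε⌋₊` and its successor; both are fine
  -- enough for `ε`.
  have hfloor : ∀ ε > 0, ∀ k : ℕ, ⌊1 / ε⌋₊ ≤ k → 1 / (k + 1 : ℝ) ≤ ε := by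
    intro ε hε k hk
    have h1 := Nat.lt_floor_add_one (1 / ε)
    have h2 : (⌊1 / ε⌋₊ : ℝ) ≤ k := by exact_mod_cast hk
    rw [div_le_iff₀ (by positivity), mul_comm, ← div_le_iff₀ hε]
    linarith
  refine ⟨r, hrpos, fun x hx => (hRs (hsub hx)).2.1, fun ε x => interp (fun k => F k x) (1 / ε),
    contDiffOn_interp fun k => (hFsm k).contDiffOn, fun ε hε x hx S hSc hS => ?_,
    fun hG1 => ?_⟩
  · exact interp_mem hSc (hFg ε hε x hx S hS _ (hfloor ε hε _ le_rfl))
      (hFg ε hε x hx S hS _ (hfloor ε hε _ (Nat.le_succ _)))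
  · obtain ⟨L, hLnn, hGb, hGlip⟩ := hlip hG1
    have hGd : DifferentiableOn ℝ G (ball x₀ (2 * r)) :=
      (hG1.1.differentiableOn one_ne_zero).mono fun x hx => hUs x (ball_subset_closedBall hx)
    set C₀ := Λ * (κ + ‖q‖ + L * κ) with hC₀
    have hC₀nn : 0 ≤ C₀ := by positivity
    have hFk : ∀ k m : ℕ, m ≤ k → F k ∈ {u : V → W | ContDiff ℝ ∞ u ∧
        ∀ x ∈ ball x₀ r, ‖u x - G x‖ ≤ C₀ / (m + 1) ∧
          ‖fderiv ℝ u x - fderiv ℝ G x‖ ≤ C₀ / (m + 1) ∧ ‖fderiv ℝ (fderiv ℝ u) x‖ ≤ L} := by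
      intro k m hmk
      refine ⟨hFsm k, fun x hx => ?_⟩
      have hfd : fderiv ℝ (F k) = fderiv ℝ (F' k) := by
        ext1 y
        exact fderiv_add_const _
      obtain ⟨h1, h2⟩ := hF'4 k L hLnn hGd
        (fun x hx y hy => hGlip x (hRs (ball_subset_closedBall hx)).1 y
          (hRs (ball_subset_closedBall hy)).1) x hx
      have hlk : lam k ≤ Λ / (m + 1) := by
        have : (m : ℝ) ≤ k := by exact_mod_cast hmk
        rw [hlam]
        dsimp only
        gcongr
      have hC₀m : C₀ / (m + 1) = Λ / (m + 1) * (κ + ‖q‖ + L * κ) := by rw [hC₀]; ring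
      rw [hfd]
      refine ⟨?_, ?_, h2⟩
      · calc ‖F k x - G x‖ = ‖(F' k x - G x) + lam k • q‖ := by
              rw [hF, add_sub_right_comm]
          _ ≤ κ * lam k + lam k * ‖q‖ := by
              refine (norm_add_le _ _).trans (add_le_add (hF'2 k x hx) ?_)
              rw [norm_smul, Real.norm_of_nonneg (hlampos k).le]
          _ = lam k * (κ + ‖q‖) := by ring
          _ ≤ lam k * (κ + ‖q‖ + L * κ) :=
              mul_le_mul_of_nonneg_left (le_add_of_nonneg_right (by positivity)) (hlampos k).le
          _ ≤ _ := by rw [hC₀m]; gcongr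
      · calc _ ≤ L * (κ * lam k) := h1
          _ = lam k * (L * κ) := by ring
          _ ≤ lam k * (κ + ‖q‖ + L * κ) :=
              mul_le_mul_of_nonneg_left (le_add_of_nonneg_left (by positivity)) (hlampos k).le
          _ ≤ _ := by rw [hC₀m]; gcongr
    -- `C₀` controls the distance to `G`, `‖G x₀‖ + 1` the size of `G`, and `L` both its derivative
    -- and the second derivatives of the approximations.
    refine ⟨C₀ + 2 * L + (‖G x₀‖ + 1), by positivity, fun ε hε x hx => ?_⟩
    set m := ⌊1 / ε⌋₊ with hm
    have hmem := interp_mem (t := 1 / ε) (convex_C1_close_C2_bounded G (ball x₀ r) (C₀ / (m + 1)) L)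
      (hFk m m le_rfl) (hFk (m + 1) m (Nat.le_succ m))
    set u := interp F (1 / ε) with hu
    have hux : (fun y => interp (fun k => F k y) (1 / ε)) = u := by
      ext1 y; simp [hu, interp]
    obtain ⟨husm, hub⟩ := hmem
    obtain ⟨h1, h2, h3⟩ := hub x hx
    have hm1 : C₀ / (m + 1) ≤ C₀ * ε := by
      calc C₀ / (m + 1) = C₀ * (1 / (m + 1)) := by ring
        _ ≤ C₀ * ε := mul_le_mul_of_nonneg_left (hfloor ε hε m le_rfl) hC₀nn
    have hm2 : C₀ / (m + 1) ≤ C₀ := div_le_self hC₀nn (by linarith [(Nat.cast_nonneg m : (0 : ℝ) ≤ m)])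
    have hm3 : C₀ * ε ≤ (C₀ + 2 * L + (‖G x₀‖ + 1)) * ε := by
      gcongr
      have : 0 ≤ 2 * L + (‖G x₀‖ + 1) := by positivity
      linarith
    have hux' : ∀ y, interp (fun k => F k y) (1 / ε) = u y := fun y => congrFun hux y
    simp only [hux']
    have hGn := norm_nonneg (G x₀)
    constructor
    · intro j hj
      interval_cases j
      · rw [norm_iteratedFDeriv_zero]
        linarith
      · rw [norm_iteratedFDeriv_one, fderiv_fun_sub (husm.differentiable (by simp) x)
          (hGd.differentiableAt (isOpen_ball.mem_nhds (ball_subset_ball (by linarith) hx)))]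
        linarith
    · intro j hj
      interval_cases j
      · rw [norm_iteratedFDeriv_zero]
        have h4 := norm_le_norm_sub_add (u x) (G x)
        have h5 := norm_le_norm_sub_add (G x) (G x₀)
        have h6 := (hRs (hsub hx)).2.2
        linarith
      · rw [norm_iteratedFDeriv_one]
        have h4 := norm_le_norm_sub_add (fderiv ℝ u x) (fderiv ℝ G x)
        have h5 := hGb x (hRs (hsub hx)).1
        linarith
      · rw [← norm_iteratedFDeriv_fderiv, norm_iteratedFDeriv_one]
        linarith

set_option maxSynthPendingDepth 3 in
/-- Near a point where `G` is Lorentzian there is a smooth family of good forms. -/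
theorem exists_local_family [MeasurableSpace V] [BorelSpace V] {σ : ℝ} (hσ : σ = 1 ∨ σ = -1)
    {U : Set V} (hU : IsOpen U) {x₀ : V}
    (hx₀ : x₀ ∈ U) {G H : V → V →L[ℝ] V →L[ℝ] ℝ} (hG : ContinuousOn G U) (hH : ContinuousOn H U)
    (hsymm : ∀ x ∈ U, ∀ X Y, G x X Y = G x Y X) (hL : LorentzForm (G x₀))
    (hpos : ∀ w ≠ 0, 0 < H x₀ w w) :
    ∃ r > 0, ball x₀ r ⊆ U ∧ ∃ F : ℝ → V → V →L[ℝ] V →L[ℝ] ℝ,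
      ContDiffOn ℝ ∞ (fun q : ℝ × V => F q.1 q.2) (Ioi 0 ×ˢ ball x₀ r) ∧
      (∀ ε > 0, ∀ x ∈ ball x₀ r, GoodForm σ ε (G x) (H x) (F ε x)) ∧
      (C11On G U → ApproxOn F G (ball x₀ r)) := by
  obtain ⟨θ, κ, Λ, ν, hκ, hΛ, hν, hgood⟩ := exists_goodForm_nhds hσ hL hpos
  have hN : {x | ‖G x - G x₀‖ ≤ ν ∧ ‖H x - H x₀‖ ≤ ν} ∈ 𝓝 x₀ := by
    have key : ∀ {G : V → V →L[ℝ] V →L[ℝ] ℝ}, ContinuousOn G U →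
        ∀ᶠ x in 𝓝 x₀, ‖G x - G x₀‖ < ν := fun hG =>
      ((hG.continuousAt (hU.mem_nhds hx₀)).sub continuousAt_const).norm.eventually_lt_const
        (by simpa using hν)
    filter_upwards [key hG, key hH] with x hx hx'
    exact ⟨hx.le, hx'.le⟩
  -- The flip of arguments: its fixed points are the symmetric forms.
  let A : (V →L[ℝ] V →L[ℝ] ℝ) →L[ℝ] (V →L[ℝ] V →L[ℝ] ℝ) :=
    (ContinuousLinearMap.flipₗᵢ ℝ V V ℝ).toContinuousLinearEquiv
  have hAb : ∀ (b : V →L[ℝ] V →L[ℝ] ℝ) X Y, A b X Y = b Y X := fun b X Y => rfl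
  obtain ⟨r, hr, hrU, F, hF1, hF2, hF3⟩ := exists_smooth_family hU hx₀ hG hN A
    (fun x hx => by ext X Y; rw [hAb]; exact hsymm x hx Y X) (q := σ • θ.smulRight θ)
    (by ext X Y; rw [hAb]; simp [mul_comm (θ X)]) hκ hΛ
  refine ⟨r, hr, fun x hx => (hrU hx).1, F, hF1, fun ε hε x hx => ?_, hF3⟩
  refine hF2 ε hε x hx {b | GoodForm σ ε (G x) (H x) b} (convex_goodForm σ ε _ _) ?_
  intro lam hl hlΛ hlε b hb hbq
  refine hgood _ _ _ lam ε (hrU hx).2.1 (hrU hx).2.2 hl hlΛ hlε (fun X Y => ?_) ?_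
  · rw [← hAb b Y X, hb]
  · rwa [mul_comm σ, mul_smul]

end Local

/-! ### Tensor fields in charts -/

section Charts

variable {n : ℕ} {M : Type*} [TopologicalSpace M] [ChartedSpace (E n) M]

/-- The tensor field `g` read in the chart `φ`. -/
def rep (g : TensorField n M) (φ : OpenPartialHomeomorph M (E n)) (x : E n) :
    E n →L[ℝ] E n →L[ℝ] ℝ :=
  pull (g (φ.symm x)) (mfderiv (𝓡 n) (𝓡 n) φ.symm x : E n →L[ℝ] TangentSpace (𝓡 n) (φ.symm x))

/-- The tensor field given by `F` in the chart `φ`. -/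
def ofRep (F : E n → E n →L[ℝ] E n →L[ℝ] ℝ) (φ : OpenPartialHomeomorph M (E n)) :
    TensorField n M := fun p =>
  pull (F (φ p)) (mfderiv (𝓡 n) (𝓡 n) φ p : TangentSpace (𝓡 n) p →L[ℝ] E n)

/-- All tangent spaces are definitionally `E n`, so the same vectors may be used at both base
points; this avoids casts between fibres. -/
theorem TensorField.apply_congr (g : TensorField n M) {p q : M} (h : p = q) (u v : E n) :
    g p u v = g q u v := by subst h; rfl

theorem mdifferentiable_of_mem_maximalAtlas {φ : OpenPartialHomeomorph M (E n)}
    (hφ : φ ∈ IsManifold.maximalAtlas (𝓡 n) ∞ M) : φ.MDifferentiable (𝓡 n) (𝓡 n) :=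
  ⟨(contMDiffOn_of_mem_maximalAtlas hφ).mdifferentiableOn (by simp),
    (contMDiffOn_symm_of_mem_maximalAtlas hφ).mdifferentiableOn (by simp)⟩

theorem contDiffOn_transition {φ φ' : OpenPartialHomeomorph M (E n)}
    (hφ : φ ∈ IsManifold.maximalAtlas (𝓡 n) ∞ M) (hφ' : φ' ∈ IsManifold.maximalAtlas (𝓡 n) ∞ M) :
    ContDiffOn ℝ ∞ (φ' ∘ φ.symm) (φ.target ∩ φ.symm ⁻¹' φ'.source) := by
  have h := (contMDiffOn_of_mem_maximalAtlas hφ').comp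
    ((contMDiffOn_symm_of_mem_maximalAtlas hφ).mono (inter_subset_left (t := φ.symm ⁻¹' φ'.source)))
    fun x hx => hx.2
  exact contMDiffOn_iff_contDiffOn.1 h

theorem symm_deriv_deriv {φ : OpenPartialHomeomorph M (E n)}
    (hφ : φ ∈ IsManifold.maximalAtlas (𝓡 n) ∞ M) {p : M} (hp : p ∈ φ.source) (v : E n) :
    (mfderiv (𝓡 n) (𝓡 n) φ.symm (φ p) (mfderiv (𝓡 n) (𝓡 n) φ p v : E n) : E n) = v :=
  DFunLike.congr_fun ((mdifferentiable_of_mem_maximalAtlas hφ).symm_comp_deriv hp) v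

theorem deriv_symm_deriv {φ : OpenPartialHomeomorph M (E n)}
    (hφ : φ ∈ IsManifold.maximalAtlas (𝓡 n) ∞ M) {p : M} (hp : p ∈ φ.source) (v : E n) :
    (mfderiv (𝓡 n) (𝓡 n) φ p (mfderiv (𝓡 n) (𝓡 n) φ.symm (φ p) v : E n) : E n) = v := by
  have h := DFunLike.congr_fun ((mdifferentiable_of_mem_maximalAtlas hφ).comp_symm_deriv
    (φ.map_source hp)) v
  have h2 : (mfderiv (𝓡 n) (𝓡 n) φ (φ.symm (φ p)) (mfderiv (𝓡 n) (𝓡 n) φ.symm (φ p) v : E n) : E n)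
      = v := h
  rwa [φ.left_inv hp] at h2

theorem ofRep_rep (g : TensorField n M) {φ : OpenPartialHomeomorph M (E n)}
    (hφ : φ ∈ IsManifold.maximalAtlas (𝓡 n) ∞ M) {p : M} (hp : p ∈ φ.source) :
    ofRep (rep g φ) φ p = g p := by
  ext u v
  have h1 := symm_deriv_deriv hφ hp u
  have h2 := symm_deriv_deriv hφ hp v
  have h3 : ofRep (rep g φ) φ p u v = g (φ.symm (φ p))
    (mfderiv (𝓡 n) (𝓡 n) φ.symm (φ p) (mfderiv (𝓡 n) (𝓡 n) φ p u : E n) : E n)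
    (mfderiv (𝓡 n) (𝓡 n) φ.symm (φ p) (mfderiv (𝓡 n) (𝓡 n) φ p v : E n) : E n) := rfl
  rw [h3, h1, h2]
  exact g.apply_congr (φ.left_inv hp) u v

theorem rep_ofRep (F : E n → E n →L[ℝ] E n →L[ℝ] ℝ) {φ φ' : OpenPartialHomeomorph M (E n)}
    (hφ : φ ∈ IsManifold.maximalAtlas (𝓡 n) ∞ M) (hφ' : φ' ∈ IsManifold.maximalAtlas (𝓡 n) ∞ M)
    {x : E n} (hx : x ∈ φ.target) (hx' : φ.symm x ∈ φ'.source) :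
    rep (ofRep F φ') φ x = pull (F ((φ' ∘ φ.symm) x)) (fderiv ℝ (φ' ∘ φ.symm) x) := by
  have hc : (mfderiv (𝓡 n) (𝓡 n) (φ' ∘ φ.symm) x) =
      (mfderiv (𝓡 n) (𝓡 n) φ' (φ.symm x)).comp (mfderiv (𝓡 n) (𝓡 n) φ.symm x) :=
    mfderiv_comp x ((mdifferentiable_of_mem_maximalAtlas hφ').mdifferentiableAt hx')
      ((mdifferentiable_of_mem_maximalAtlas hφ).mdifferentiableAt_symm hx)
  rw [mfderiv_eq_fderiv] at hc
  rw [hc]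
  rfl

theorem GoodForm.ofRep {σ ε : ℝ} {g h : TensorField n M} {F : E n → E n →L[ℝ] E n →L[ℝ] ℝ}
    {φ : OpenPartialHomeomorph M (E n)} (hφ : φ ∈ IsManifold.maximalAtlas (𝓡 n) ∞ M) {p : M}
    (hp : p ∈ φ.source) (hF : GoodForm σ ε (rep g φ (φ p)) (rep h φ (φ p)) (F (φ p))) :
    GoodForm σ ε (g p) (h p) (LorentzApprox.ofRep F φ p) := by
  rw [← ofRep_rep g hφ hp, ← ofRep_rep h hφ hp]
  exact goodForm_pull hF _ (mfderiv (𝓡 n) (𝓡 n) φ.symm (φ p) : E n →L[ℝ] E n)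
    (symm_deriv_deriv hφ hp) (deriv_symm_deriv hφ hp)

/-- The bilinear form with a single nonzero matrix entry. -/
def elemForm (i j : Fin n) : E n →L[ℝ] E n →L[ℝ] ℝ :=
  (EuclideanSpace.proj i : E n →L[ℝ] ℝ).smulRight (EuclideanSpace.proj j : E n →L[ℝ] ℝ)

theorem eq_sum_elemForm (b : E n →L[ℝ] E n →L[ℝ] ℝ) :
    b = ∑ i, ∑ j, b (EuclideanSpace.single i (1 : ℝ)) (EuclideanSpace.single j (1 : ℝ)) •
      elemForm i j := by
  have hsum : ∀ u : E n, u = ∑ i, u i • EuclideanSpace.single i (1 : ℝ) := fun u => by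
    simpa using ((EuclideanSpace.basisFun (Fin n) ℝ).sum_repr u).symm
  ext u v
  conv_lhs => rw [hsum u, hsum v]
  simp [elemForm, Finset.mul_sum]
  rw [Finset.sum_comm]
  exact Finset.sum_congr rfl fun i _ => Finset.sum_congr rfl fun j _ => by ring

theorem locallyLipschitzOn_add {V W : Type*} [PseudoEMetricSpace V] [NormedAddCommGroup W]
    {s : Set V} {f g : V → W}
    (hf : LocallyLipschitzOn s f) (hg : LocallyLipschitzOn s g) :
    LocallyLipschitzOn s (fun x => f x + g x) := by
  intro x hx
  obtain ⟨K, t, ht, hK⟩ := hf hx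
  obtain ⟨K', t', ht', hK'⟩ := hg hx
  exact ⟨K + K', t ∩ t', inter_mem ht ht', (hK.mono inter_subset_left).add
    (hK'.mono inter_subset_right)⟩

theorem C11On.sum {V W ι : Type*} [NormedAddCommGroup V] [NormedSpace ℝ V]
    [NormedAddCommGroup W] [NormedSpace ℝ W] {U : Set V} (hU : IsOpen U) {f : ι → V → W}
    (s : Finset ι) (hf : ∀ i ∈ s, C11On (f i) U) : C11On (fun x => ∑ i ∈ s, f i x) U := by
  classical
  induction s using Finset.induction_on with
  | empty =>
    refine ⟨by simpa using contDiffOn_const, ?_⟩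
    simp only [Finset.sum_empty, fderiv_fun_const]
    exact (LocallyLipschitz.const 0).locallyLipschitzOn
  | insert a s ha ih =>
    have h1 := hf a (Finset.mem_insert_self _ _)
    have h2 := ih fun i hi => hf i (Finset.mem_insert_of_mem hi)
    simp only [Finset.sum_insert ha]
    refine ⟨h1.1.add h2.1, fun x hx => ?_⟩
    obtain ⟨K, t, ht, hK⟩ := locallyLipschitzOn_add h1.2 h2.2 hx
    refine ⟨K, t ∩ U, inter_mem ht self_mem_nhdsWithin, ?_⟩
    have hd : ∀ y ∈ U, fderiv ℝ (fun x => f a x + ∑ i ∈ s, f i x) y =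
        fderiv ℝ (f a) y + fderiv ℝ (fun x => ∑ i ∈ s, f i x) y := fun y hy =>
      fderiv_fun_add ((h1.1.differentiableOn one_ne_zero).differentiableAt (hU.mem_nhds hy))
        ((h2.1.differentiableOn one_ne_zero).differentiableAt (hU.mem_nhds hy))
    intro y hy z hz
    rw [hd y hy.2, hd z hz.2]
    exact hK hy.1 hz.1

theorem C11On.smul_const {V W : Type*} [NormedAddCommGroup V] [NormedSpace ℝ V]
    [NormedAddCommGroup W] [NormedSpace ℝ W] {U : Set V} (hU : IsOpen U) {f : V → ℝ}
    (hf : C11On f U) (w : W) : C11On (fun x => f x • w) U := by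
  refine ⟨hf.1.smul contDiffOn_const, fun x hx => ?_⟩
  obtain ⟨K, t, ht, hK⟩ := hf.2 hx
  refine ⟨K * ‖w‖₊, t ∩ U, inter_mem ht self_mem_nhdsWithin, ?_⟩
  refine LipschitzOnWith.of_dist_le_mul fun y hy z hz => ?_
  have hd : ∀ y ∈ U, fderiv ℝ (fun x => f x • w) y = (fderiv ℝ f y).smulRight w := fun y hy =>
    fderiv_smul_const ((hf.1.differentiableOn one_ne_zero).differentiableAt (hU.mem_nhds hy)) w
  rw [hd y hy.2, hd z hz.2, dist_eq_norm]
  have : (fderiv ℝ f y).smulRight w - (fderiv ℝ f z).smulRight w =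
      (fderiv ℝ f y - fderiv ℝ f z).smulRight w := by
    ext; simp [sub_smul]
  rw [this, ContinuousLinearMap.norm_smulRight_apply, dist_eq_norm]
  have h2 := hK.norm_sub_le hy.1 hz.1
  calc _ ≤ K * ‖y - z‖ * ‖w‖ := by gcongr
    _ = _ := by push_cast; ring

theorem TensorField.IsC11.c11On_rep {g : TensorField n M} (hg : g.IsC11)
    {φ : OpenPartialHomeomorph M (E n)} (hφ : φ ∈ IsManifold.maximalAtlas (𝓡 n) ∞ M) :
    C11On (rep g φ) φ.target := by
  have h : rep g φ = fun x => ∑ i, ∑ j, component g φ i j x • elemForm i j := by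
    ext1 x
    exact eq_sum_elemForm _
  rw [h]
  exact C11On.sum φ.open_target _ fun i _ => C11On.sum φ.open_target _ fun j _ =>
    C11On.smul_const φ.open_target (hg φ hφ i j) _

variable [IsManifold (𝓡 n) ∞ M]

theorem trivializationAt_cotangent_apply {p₀ p : M} (l : TangentSpace (𝓡 n) p →L[ℝ] ℝ) (v : E n) :
    (trivializationAt (E n →L[ℝ] ℝ)
      (fun p : M => TangentSpace (𝓡 n) p →L[ℝ] Bundle.Trivial M ℝ p) p₀ ⟨p, l⟩).2 v =
      l ((trivializationAt (E n) (TangentSpace (𝓡 n) : M → Type _) p₀).symmL ℝ p v) := by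
  rw [hom_trivializationAt_apply]
  simp [ContinuousLinearMap.inCoordinates]

/-- The bridge between the bundle and analysis on `E n`: continuity and smoothness in the total
space become statements about `rep`. -/
theorem trivializationAt_apply_snd (b : TensorField n M) (p₀ : M) {p : M}
    (hp : p ∈ (chartAt (E n) p₀).source) :
    (trivializationAt (E n →L[ℝ] E n →L[ℝ] ℝ) (fun p : M => BilinAt n p) p₀
      ⟨p, b p⟩).2 = rep b (chartAt (E n) p₀) (chartAt (E n) p₀ p) := by
  have hs : (trivializationAt (E n) (TangentSpace (𝓡 n) : M → Type _) p₀).symmL ℝ p =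
      mfderiv (𝓡 n) (𝓡 n) (chartAt (E n) p₀).symm (chartAt (E n) p₀ p) := by
    rw [TangentBundle.symmL_trivializationAt (I := 𝓡 n) hp]
    simp [mfderivWithin_univ]
    rfl
  have hb2 : p ∈ (trivializationAt (E n →L[ℝ] ℝ)
      (fun p : M => TangentSpace (𝓡 n) p →L[ℝ] Bundle.Trivial M ℝ p) p₀).baseSet := by
    rw [hom_trivializationAt_baseSet]
    exact ⟨hp, mem_univ _⟩
  ext u v
  rw [hom_trivializationAt_apply]
  simp only [ContinuousLinearMap.inCoordinates, ContinuousLinearMap.comp_apply]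
  rw [Trivialization.continuousLinearMapAt_apply, Trivialization.coe_linearMapAt_of_mem _ hb2]
  refine (trivializationAt_cotangent_apply _ v).trans ?_
  rw [hs]
  exact b.apply_congr ((chartAt (E n) p₀).left_inv hp).symm _ _

theorem TensorField.IsContinuous.continuousOn_rep {g : TensorField n M} (hg : g.IsContinuous)
    (p₀ : M) : ContinuousOn (rep g (chartAt (E n) p₀)) (chartAt (E n) p₀).target := by
  set φ := chartAt (E n) p₀ with hφ
  set e := trivializationAt (E n →L[ℝ] E n →L[ℝ] ℝ) (fun p : M => BilinAt n p) p₀ with he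
  have hsrc : ∀ p ∈ φ.source, (⟨p, g p⟩ :
      TotalSpace (E n →L[ℝ] E n →L[ℝ] ℝ) (fun p : M => BilinAt n p)) ∈ e.source := by
    intro p hp
    rw [e.mem_source, he, hom_trivializationAt_baseSet, hom_trivializationAt_baseSet]
    exact ⟨hp, hp, mem_univ _⟩
  have h1 : ContinuousOn (fun p => (e ⟨p, g p⟩).2) φ.source :=
    (continuous_snd.comp_continuousOn e.continuousOn).comp hg.continuousOn hsrc
  refine (h1.comp φ.continuousOn_symm fun x hx => φ.map_target hx).congr fun x hx => ?_
  simp only [Function.comp_apply]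
  rw [he, trivializationAt_apply_snd g p₀ (φ.map_target hx), ← hφ, φ.right_inv hx]

theorem smoothFamily_of_rep {g : ℝ → TensorField n M}
    (hg : ∀ p₀ : M, ∀ ε > 0, ContDiffAt ℝ ∞
      (fun q : ℝ × E n => rep (g q.1) (chartAt (E n) p₀) q.2) (ε, chartAt (E n) p₀ p₀)) :
    SmoothFamily g := by
  rintro ⟨ε, p₀⟩ ⟨hε, -⟩
  refine ContMDiffAt.contMDiffWithinAt ?_
  rw [contMDiffAt_totalSpace]
  refine ⟨contMDiffAt_snd, ?_⟩
  have h1 := (hg p₀ ε hε).contMDiffAt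
  have hφ : ContMDiffAt (𝓘(ℝ, ℝ).prod (𝓡 n)) 𝓘(ℝ, ℝ × E n) ∞
      (fun q : ℝ × M => (q.1, chartAt (E n) p₀ q.2)) (ε, p₀) := by
    refine contMDiffAt_fst.prodMk_space ?_
    exact ContMDiffAt.comp (ε, p₀)
      (contMDiffAt_of_mem_maximalAtlas (IsManifold.chart_mem_maximalAtlas p₀)
        (mem_chart_source _ p₀)) contMDiffAt_snd
  refine (ContMDiffAt.comp (ε, p₀) h1 hφ).congr_of_eventuallyEq ?_
  have : ∀ᶠ q : ℝ × M in 𝓝 (ε, p₀), q.2 ∈ (chartAt (E n) p₀).source :=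
    continuousAt_snd.eventually_mem ((chartAt (E n) p₀).open_source.mem_nhds
      (mem_chart_source _ p₀))
  filter_upwards [this] with q hq
  exact trivializationAt_apply_snd (g q.1) p₀ hq

theorem SmoothFamily.isSmooth {g : ℝ → TensorField n M} (hg : SmoothFamily g) {ε : ℝ} (hε : 0 < ε) :
    (g ε).IsSmooth := by
  intro p
  have h1 := (hg (ε, p) ⟨hε, mem_univ _⟩).contMDiffAt
    ((isOpen_Ioi.prod isOpen_univ).mem_nhds ⟨hε, mem_univ _⟩)
  exact ContMDiffAt.comp p h1 (f := fun p : M => (ε, p))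
    (contMDiffAt_const.prodMk contMDiffAt_id)

end Charts

/-! ### Pullback as a smooth operator -/

section PullOp

variable {V : Type*} [NormedAddCommGroup V] [NormedSpace ℝ V]

set_option maxSynthPendingDepth 3 in
/-- Pullback of bilinear forms, as an operator. -/
def pullOp (A : V →L[ℝ] V) : (V →L[ℝ] V →L[ℝ] ℝ) →L[ℝ] (V →L[ℝ] V →L[ℝ] ℝ) :=
  (ContinuousLinearMap.compL ℝ V (V →L[ℝ] ℝ) (V →L[ℝ] ℝ)
    ((ContinuousLinearMap.compL ℝ V V ℝ).flip A)).comp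
      ((ContinuousLinearMap.compL ℝ V V (V →L[ℝ] ℝ)).flip A)

theorem pullOp_apply (A : V →L[ℝ] V) (b : V →L[ℝ] V →L[ℝ] ℝ) : pullOp A b = pull b A := rfl

set_option maxSynthPendingDepth 3 in
-- Pullback is a composition of two operators, each linear in `A`.
theorem contDiff_pullOp : ContDiff ℝ ∞ (pullOp (V := V)) := by
  unfold pullOp
  refine ContDiff.clm_comp ?_ ?_
  · exact (ContinuousLinearMap.contDiff _).comp (ContinuousLinearMap.contDiff _)
  · exact ContinuousLinearMap.contDiff _

theorem pull_sum {V V' ι : Type*} [TopologicalSpace V] [AddCommGroup V] [Module ℝ V]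
    [TopologicalSpace V'] [AddCommGroup V'] [Module ℝ V'] (s : Finset ι) (c : ι → ℝ)
    (b : ι → V' →L[ℝ] V' →L[ℝ] ℝ) (A : V →L[ℝ] V') :
    pull (∑ i ∈ s, c i • b i) A = ∑ i ∈ s, c i • pull (b i) A := by
  ext u v
  simp

theorem LorentzForm.pull {V V' : Type*} [TopologicalSpace V] [AddCommGroup V] [Module ℝ V]
    [TopologicalSpace V'] [AddCommGroup V'] [Module ℝ V'] {b : V' →L[ℝ] V' →L[ℝ] ℝ}
    (hb : LorentzForm b) (A : V →L[ℝ] V') (B : V' →L[ℝ] V) (hBA : ∀ v, B (A v) = v)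
    (hAB : ∀ v, A (B v) = v) : LorentzForm (LorentzApprox.pull b A) := by
  obtain ⟨hs, v, hv, hvw⟩ := hb
  refine ⟨fun X Y => hs _ _, B v, by simpa [hAB] using hv, fun w hw h => ?_⟩
  exact hvw (A w) (fun h0 => hw (by rw [← hBA w, h0, map_zero])) (by simpa [hAB] using h)

end PullOp

/-! ### Stability of the approximation estimates -/

section ApproxOn

variable {V W W' : Type*} [NormedAddCommGroup V] [NormedSpace ℝ V]
  [NormedAddCommGroup W] [NormedSpace ℝ W] [NormedAddCommGroup W'] [NormedSpace ℝ W']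

theorem two_le_infty : (2 : WithTop ℕ∞) ≤ ((⊤ : ℕ∞) : WithTop ℕ∞) := by
  exact ENat.LEInfty.out

/-- The operation is linear in the function, so its `C^1` bound applies to `F ε - G` and its `C^2`
bound to `F ε`, with constants free of `ε`. -/
theorem ApproxOn.exists_clm_apply_comp {F : ℝ → V → W} {G : V → W} {U : Set V} (hU : IsOpen U)
    (hF : ∀ ε > 0, ContDiffOn ℝ ∞ (F ε) U) (hG : ContDiffOn ℝ 1 G U) (h : ApproxOn F G U)
    {ψ : V → V} {x₁ : V} (hψ : ContDiffAt ℝ ∞ ψ x₁) (hx₁ : ψ x₁ ∈ U) {a : V → W →L[ℝ] W'}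
    (ha : ContDiffAt ℝ ∞ a x₁) : ∃ s ∈ 𝓝 x₁, IsOpen s ∧
      ContDiffOn ℝ 1 (fun y => a y (G (ψ y))) s ∧
      (∀ ε > 0, ContDiffOn ℝ 2 (fun y => a y (F ε (ψ y))) s) ∧
      ApproxOn (fun ε y => a y (F ε (ψ y))) (fun y => a y (G (ψ y))) s := by
  obtain ⟨C, hC, hb⟩ := h
  obtain ⟨s₁, hs₁, hs₁o, A₁, hA₁, h₁⟩ := exists_bound_clm_apply_comp hU hψ hx₁ ha 1
  obtain ⟨s₂, hs₂, hs₂o, A₂, hA₂, h₂⟩ := exists_bound_clm_apply_comp hU hψ hx₁ ha 2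
  refine ⟨s₁ ∩ s₂, inter_mem hs₁ hs₂, hs₁o.inter hs₂o, ?_, fun ε hε => ?_,
    A₁ * C + A₂ * C, by positivity, fun ε hε x hx => ⟨fun j hj => ?_, fun j hj => ?_⟩⟩
  · exact (h₁ G (by exact_mod_cast hG)).1.mono inter_subset_left
  · exact (h₂ (F ε) ((hF ε hε).of_le (by exact_mod_cast two_le_infty))).1.mono inter_subset_right
  · have hsub : (fun y => a y (F ε (ψ y)) - a y (G (ψ y))) =
        fun y => a y ((fun z => F ε z - G z) (ψ y)) := by
      ext1 y; rw [map_sub]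
    rw [hsub]
    refine ((h₁ (fun z => F ε z - G z) (((hF ε hε).of_le (by simp)).sub
      (by exact_mod_cast hG))).2 (C * ε) (by positivity) (fun x hx => (hb ε hε x hx).1)
      x hx.1 j hj).trans ?_
    have : 0 ≤ A₂ * C * ε := by positivity
    linarith
  · refine ((h₂ (F ε) ((hF ε hε).of_le (by exact_mod_cast two_le_infty))).2 C hC
      (fun x hx => (hb ε hε x hx).2) x hx.2 j hj).trans ?_
    have : 0 ≤ A₁ * C := by positivity
    linarith

theorem ApproxOn.sum {ι : Type*} {I : Finset ι} {F : ι → ℝ → V → W} {G : ι → V → W} {s : Set V}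
    (hs : IsOpen s) (hG : ∀ i ∈ I, ContDiffOn ℝ 1 (G i) s)
    (hF : ∀ i ∈ I, ∀ ε > 0, ContDiffOn ℝ 2 (F i ε) s) (h : ∀ i ∈ I, ApproxOn (F i) (G i) s) :
    ApproxOn (fun ε x => ∑ i ∈ I, F i ε x) (fun x => ∑ i ∈ I, G i x) s := by
  choose! C hC hb using h
  refine ⟨∑ i ∈ I, C i, Finset.sum_nonneg hC, fun ε hε x hx => ⟨fun j hj => ?_, fun j hj => ?_⟩⟩
  · have hsub : (fun y => ∑ i ∈ I, F i ε y - ∑ i ∈ I, G i y) =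
        fun y => ∑ i ∈ I, (fun z => F i ε z - G i z) y := by
      ext1 y; rw [Finset.sum_sub_distrib]
    rw [hsub, iteratedFDeriv_fun_sum_apply fun i hi => ?_]
    · refine (norm_sum_le _ _).trans ?_
      rw [Finset.sum_mul]
      exact Finset.sum_le_sum fun i hi => (hb i hi ε hε x hx).1 j hj
    · have hj' : ((j : ℕ) : WithTop ℕ∞) ≤ 1 := by exact_mod_cast hj
      exact ((((hF i hi ε hε).of_le (by norm_num)).sub (hG i hi)).contDiffAt
        (hs.mem_nhds hx)).of_le hj'
  · rw [iteratedFDeriv_fun_sum_apply fun i hi => ?_]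
    · exact (norm_sum_le _ _).trans (Finset.sum_le_sum fun i hi => (hb i hi ε hε x hx).2 j hj)
    · have hj' : ((j : ℕ) : WithTop ℕ∞) ≤ 2 := by exact_mod_cast hj
      exact ((hF i hi ε hε).contDiffAt (hs.mem_nhds hx)).of_le hj'

theorem ApproxOn.mono {F : ℝ → V → W} {G : V → W} {s t : Set V} (h : ApproxOn F G t)
    (hst : s ⊆ t) : ApproxOn F G s := by
  obtain ⟨C, hC, hb⟩ := h
  exact ⟨C, hC, fun ε hε x hx => hb ε hε x (hst hx)⟩

theorem ApproxOn.congr {F F' : ℝ → V → W} {G G' : V → W} {s : Set V} (hs : IsOpen s)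
    (h : ApproxOn F G s) (hF : ∀ ε, ∀ x ∈ s, F' ε x = F ε x) (hG : ∀ x ∈ s, G' x = G x) :
    ApproxOn F' G' s := by
  obtain ⟨C, hC, hb⟩ := h
  refine ⟨C, hC, fun ε hε x hx => ⟨fun j hj => ?_, fun j hj => ?_⟩⟩
  · have he : (fun y => F' ε y - G' y) =ᶠ[𝓝 x] fun y => F ε y - G y := by
      filter_upwards [hs.mem_nhds hx] with y hy
      rw [hF ε y hy, hG y hy]
    rw [(he.iteratedFDeriv ℝ j).self_of_nhds]
    exact (hb ε hε x hx).1 j hj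
  · have he : F' ε =ᶠ[𝓝 x] F ε := by
      filter_upwards [hs.mem_nhds hx] with y hy
      exact hF ε y hy
    rw [(he.iteratedFDeriv ℝ j).self_of_nhds]
    exact (hb ε hε x hx).2 j hj

end ApproxOn

/-! ### Gluing by a partition of unity -/

section Glue

set_option maxSynthPendingDepth 3

variable {n : ℕ} {M : Type*} [TopologicalSpace M] [ChartedSpace (E n) M]

/-- The tensor field patched from local representations by a partition of unity. -/
def glue (χ : SmoothPartitionOfUnity M (𝓡 n) M univ) (F : M → E n → E n →L[ℝ] E n →L[ℝ] ℝ) :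
    TensorField n M := fun p => ∑ᶠ i, χ i p • ofRep (F i) (chartAt (E n) i) p

variable [IsManifold (𝓡 n) ∞ M]

/-- Presents `g` itself as a glued tensor, so that it can be compared with the approximations term
by term. -/
theorem glue_rep {χ : SmoothPartitionOfUnity M (𝓡 n) M univ}
    (hχ : χ.IsSubordinate fun i => (chartAt (E n) i).source) (g : TensorField n M) :
    glue χ (fun i => rep g (chartAt (E n) i)) = g := by
  ext1 p
  rw [glue]
  have : ∀ i, χ i p • ofRep (rep g (chartAt (E n) i)) (chartAt (E n) i) p = χ i p • g p := by
    intro i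
    by_cases h : χ i p = 0
    · rw [h]
      exact (zero_smul ℝ _).trans (zero_smul ℝ _).symm
    · rw [ofRep_rep g (IsManifold.chart_mem_maximalAtlas i)
        (hχ i (subset_tsupport _ h))]
  simp_rw [this]
  have h1 := χ.sum_finsupport_smul_eq_finsum p (fun _ _ => g p)
  rw [← h1, ← Finset.sum_smul, χ.sum_finsupport p (mem_univ p), one_smul]

/-- Local finiteness and the chain rule for transition maps. The data `I`, `ψ`, `a`, `s` do not
depend on `F`, so one formula serves all `ε` and the limit. -/
theorem exists_rep_glue {χ : SmoothPartitionOfUnity M (𝓡 n) M univ} {U : M → Set (E n)}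
    (hχ : χ.IsSubordinate fun i => (chartAt (E n) i).source ∩ chartAt (E n) i ⁻¹' U i)
    {φ : OpenPartialHomeomorph M (E n)} (hφ : φ ∈ IsManifold.maximalAtlas (𝓡 n) ∞ M) {x₁ : E n}
    (hx₁ : x₁ ∈ φ.target) :
    ∃ (I : Finset M) (ψ : M → E n → E n)
      (a : M → E n → ((E n →L[ℝ] E n →L[ℝ] ℝ) →L[ℝ] (E n →L[ℝ] E n →L[ℝ] ℝ))),
      (∀ i ∈ I, ContDiffAt ℝ ∞ (ψ i) x₁ ∧ ψ i x₁ ∈ U i ∧ ContDiffAt ℝ ∞ (a i) x₁) ∧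
      ∃ s ∈ 𝓝 x₁, IsOpen s ∧ ∀ F : M → E n → E n →L[ℝ] E n →L[ℝ] ℝ, ∀ x ∈ s,
        rep (glue χ F) φ x = ∑ i ∈ I, a i x (F i (ψ i x)) := by
  set p₁ := φ.symm x₁ with hp₁
  -- Closed supports are used: they contain every index active near `p₁`, and still put `p₁` in the
  -- corresponding chart domains.
  set I := χ.fintsupport p₁ with hI
  have hmem : ∀ i ∈ I, p₁ ∈ (chartAt (E n) i).source ∩ chartAt (E n) i ⁻¹' U i := fun i hi =>
    hχ i ((χ.mem_fintsupport_iff p₁ i).1 hi)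
  set ψ : M → E n → E n := fun i => chartAt (E n) i ∘ φ.symm with hψ
  have hopen : ∀ i, IsOpen (φ.target ∩ φ.symm ⁻¹' (chartAt (E n) i).source) := fun i =>
    φ.isOpen_inter_preimage_symm (chartAt (E n) i).open_source
  have hψs : ∀ i ∈ I, ContDiffAt ℝ ∞ (ψ i) x₁ := fun i hi =>
    (contDiffOn_transition hφ (IsManifold.chart_mem_maximalAtlas i)).contDiffAt
      ((hopen i).mem_nhds ⟨hx₁, (hmem i hi).1⟩)
  refine ⟨I, ψ, fun i x => χ i (φ.symm x) • pullOp (fderiv ℝ (ψ i) x), fun i hi =>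
    ⟨hψs i hi, (hmem i hi).2, ?_⟩, ?_⟩
  · have h1 : ContDiffAt ℝ ∞ (χ i ∘ φ.symm) x₁ := by
      have h1 : ContMDiffAt (𝓡 n) 𝓘(ℝ, ℝ) ∞ (χ i ∘ φ.symm) x₁ :=
        ((χ i).contMDiff.contMDiffAt).comp x₁ (((contMDiffOn_symm_of_mem_maximalAtlas hφ) x₁ hx₁
          ).contMDiffAt (φ.open_target.mem_nhds hx₁))
      exact contMDiffAt_iff_contDiffAt.1 h1
    have h2 : ContDiffAt ℝ ∞ (fun x => pullOp (fderiv ℝ (ψ i) x)) x₁ :=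
      contDiff_pullOp.contDiffAt.comp x₁ ((hψs i hi).fderiv_right le_rfl)
    exact ContDiffAt.fun_smul h1 h2
  · have h1 : ∀ᶠ p in 𝓝 p₁, χ.finsupport p ⊆ I := χ.eventually_finsupport_subset p₁
    have h2 : ∀ᶠ x in 𝓝 x₁, χ.finsupport (φ.symm x) ⊆ I :=
      (φ.continuousAt_symm hx₁).eventually h1
    have h3 : ∀ᶠ x in 𝓝 x₁, ∀ i ∈ I, x ∈ φ.target ∩ φ.symm ⁻¹' (chartAt (E n) i).source :=
      (Filter.eventually_all_finset I).2 fun i hi => (hopen i).eventually_mem ⟨hx₁, (hmem i hi).1⟩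
    obtain ⟨s, hs, hso, hxs⟩ := eventually_nhds_iff.1 (h2.and h3)
    refine ⟨s, hso.mem_nhds hxs, hso, fun F x hx => ?_⟩
    obtain ⟨hx2, hx3⟩ := hs x hx
    have h4 : glue χ F (φ.symm x) =
        ∑ i ∈ I, χ i (φ.symm x) • ofRep (F i) (chartAt (E n) i) (φ.symm x) := by
      rw [glue, ← χ.sum_finsupport_smul_eq_finsum (φ.symm x)
        (fun i p => ofRep (F i) (chartAt (E n) i) (φ.symm x))]
      refine Finset.sum_subset hx2 fun i _ hi => ?_
      have : χ i (φ.symm x) = 0 := by simpa using hi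
      rw [this]
      exact zero_smul ℝ _
    rw [rep, h4]
    refine (pull_sum I _ _ _).trans ?_
    refine Finset.sum_congr rfl fun i hi => ?_
    rw [smul_apply, pullOp_apply]
    congr 1
    exact rep_ofRep (F i) hφ (IsManifold.chart_mem_maximalAtlas i) (hx3 i hi).1 (hx3 i hi).2

end Glue

/-! ### The global family and its convergence -/

section Family

set_option maxSynthPendingDepth 3

variable {n : ℕ} {M : Type*} [TopologicalSpace M] [ChartedSpace (E n) M]

/-- Evaluation of a bilinear form at two basis vectors. -/
def evalCLM (i j : Fin n) : (E n →L[ℝ] E n →L[ℝ] ℝ) →L[ℝ] ℝ :=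
  (ContinuousLinearMap.apply ℝ ℝ (EuclideanSpace.single j (1 : ℝ) : E n)).comp
    (ContinuousLinearMap.apply ℝ (E n →L[ℝ] ℝ) (EuclideanSpace.single i (1 : ℝ) : E n))

theorem norm_evalCLM_le (i j : Fin n) : ‖evalCLM i j‖ ≤ 1 := by
  refine ContinuousLinearMap.opNorm_le_bound _ zero_le_one fun b => ?_
  have h : ‖b (EuclideanSpace.single i (1 : ℝ)) (EuclideanSpace.single j (1 : ℝ))‖ ≤ ‖b‖ := by
    simpa using b.le_opNorm₂ (EuclideanSpace.single i (1 : ℝ)) (EuclideanSpace.single j (1 : ℝ))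
  rw [one_mul]
  exact h

theorem norm_iteratedFDeriv_evalCLM_le {u : E n → E n →L[ℝ] E n →L[ℝ] ℝ} {x : E n} {k : ℕ}
    (hu : ContDiffAt ℝ k u x) (i j : Fin n) :
    ‖iteratedFDeriv ℝ k (fun y => evalCLM i j (u y)) x‖ ≤ ‖iteratedFDeriv ℝ k u x‖ :=
  ((evalCLM i j).norm_iteratedFDeriv_comp_left hu le_rfl).trans
    (mul_le_of_le_one_left (norm_nonneg _) (norm_evalCLM_le i j))

theorem secondDerivBounded_of_approxOn {gε : ℝ → TensorField n M} {g : TensorField n M}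
    (hsm : ∀ φ ∈ IsManifold.maximalAtlas (𝓡 n) ∞ M, ∀ x ∈ φ.target, ∀ ε > 0,
      ContDiffAt ℝ ∞ (rep (gε ε) φ) x)
    (h : ∀ φ ∈ IsManifold.maximalAtlas (𝓡 n) ∞ M, ∀ x ∈ φ.target, ∃ s ∈ 𝓝 x,
      ApproxOn (fun ε => rep (gε ε) φ) (rep g φ) s) : SecondDerivBounded gε := by
  intro φ hφ K hK hKφ
  refine hK.induction_on (p := fun K => ∃ C : ℝ, ∀ ε : ℝ, 0 < ε → ∀ x ∈ K, ∀ i j : Fin n,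
    ‖iteratedFDeriv ℝ 2 (component (gε ε) φ i j) x‖ ≤ C) ⟨0, by simp⟩ ?_ ?_ ?_
  · rintro s t hst ⟨C, hC⟩
    exact ⟨C, fun ε hε x hx => hC ε hε x (hst hx)⟩
  · rintro s t ⟨C, hC⟩ ⟨C', hC'⟩
    refine ⟨max C C', fun ε hε x hx i j => ?_⟩
    rcases hx with hx | hx
    · exact (hC ε hε x hx i j).trans (le_max_left _ _)
    · exact (hC' ε hε x hx i j).trans (le_max_right _ _)
  · intro x hx
    obtain ⟨s, hs, C, hC, hb⟩ := h φ hφ x (hKφ hx)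
    refine ⟨s ∩ φ.target, mem_nhdsWithin_of_mem_nhds
      (inter_mem hs (φ.open_target.mem_nhds (hKφ hx))), C, fun ε hε y hy i j => ?_⟩
    exact (norm_iteratedFDeriv_evalCLM_le ((hsm φ hφ y hy.2 ε hε).of_le two_le_infty) i j).trans
      ((hb ε hε y hy.1).2 2 le_rfl)

theorem tendstoUniformlyOn_of_local {X Y : Type*} [TopologicalSpace X] [NormedAddCommGroup Y]
    {f : ℝ → X → Y} {f₀ : X → Y} {K : Set X} (hK : IsCompact K)
    (h : ∀ x ∈ K, ∃ s ∈ 𝓝 x, ∃ C, 0 ≤ C ∧ ∀ ε > 0, ∀ y ∈ s, ‖f ε y - f₀ y‖ ≤ C * ε) :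
    TendstoUniformlyOn f f₀ (𝓝[>] 0) K := by
  rw [← tendstoLocallyUniformlyOn_iff_tendstoUniformlyOn_of_compact hK,
    Metric.tendstoLocallyUniformlyOn_iff]
  intro δ hδ x hx
  obtain ⟨s, hs, C, hC, hb⟩ := h x hx
  refine ⟨s, mem_nhdsWithin_of_mem_nhds hs, ?_⟩
  have : Tendsto (fun ε : ℝ => C * ε) (𝓝[>] 0) (𝓝 0) := by
    have : Tendsto (fun ε : ℝ => C * ε) (𝓝 0) (𝓝 (C * 0)) :=
      (continuous_const.mul continuous_id).tendsto 0
    rw [mul_zero] at this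
    exact this.mono_left nhdsWithin_le_nhds
  filter_upwards [this.eventually_lt_const hδ, self_mem_nhdsWithin] with ε hε hpos y hy
  rw [dist_comm, dist_eq_norm]
  exact (hb ε hpos y hy).trans_lt hε

theorem convergesC1_of_approxOn {gε : ℝ → TensorField n M} {g : TensorField n M}
    (hsm : ∀ φ ∈ IsManifold.maximalAtlas (𝓡 n) ∞ M, ∀ x ∈ φ.target, ∀ ε > 0,
      ContDiffAt ℝ ∞ (rep (gε ε) φ) x)
    (hg : ∀ φ ∈ IsManifold.maximalAtlas (𝓡 n) ∞ M, ContDiffOn ℝ 1 (rep g φ) φ.target)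
    (h : ∀ φ ∈ IsManifold.maximalAtlas (𝓡 n) ∞ M, ∀ x ∈ φ.target, ∃ s ∈ 𝓝 x,
      ApproxOn (fun ε => rep (gε ε) φ) (rep g φ) s) : ConvergesC1 gε g := by
  intro φ hφ K hK hKφ i j
  have hd : ∀ x ∈ φ.target, ∀ ε > 0, ContDiffAt ℝ 1 (fun y => rep (gε ε) φ y - rep g φ y) x :=
    fun x hx ε hε => ((hsm φ hφ x hx ε hε).of_le (by simp)).sub
      ((hg φ hφ).contDiffAt (φ.open_target.mem_nhds hx))
  have hcomp : ∀ ε, (fun y => component (gε ε) φ i j y - component g φ i j y) =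
      fun y => evalCLM i j (rep (gε ε) φ y - rep g φ y) := fun ε => by
    ext1 y
    rw [map_sub]
    rfl
  refine ⟨tendstoUniformlyOn_of_local hK fun x hx => ?_,
    tendstoUniformlyOn_of_local hK fun x hx => ?_⟩ <;>
  obtain ⟨s, hs, C, hC, hb⟩ := h φ hφ x (hKφ hx) <;>
  refine ⟨s ∩ φ.target, inter_mem hs (φ.open_target.mem_nhds (hKφ hx)), C, hC,
    fun ε hε y hy => ?_⟩
  · have h1 := (norm_iteratedFDeriv_evalCLM_le (k := 0)
      ((hd y hy.2 ε hε).of_le (by simp)) i j).trans ((hb ε hε y hy.1).1 0 zero_le_one)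
    rw [← hcomp, norm_iteratedFDeriv_zero] at h1
    exact h1
  · have h1 := (norm_iteratedFDeriv_evalCLM_le (k := 1)
      (hd y hy.2 ε hε) i j).trans ((hb ε hε y hy.1).1 1 le_rfl)
    rw [← hcomp, norm_iteratedFDeriv_one] at h1
    have d1 : DifferentiableAt ℝ (component (gε ε) φ i j) y :=
      (evalCLM i j).differentiableAt.comp y ((hsm φ hφ y hy.2 ε hε).differentiableAt (by simp))
    have d2 : DifferentiableAt ℝ (component g φ i j) y :=
      (evalCLM i j).differentiableAt.comp y
        (((hg φ hφ).contDiffAt (φ.open_target.mem_nhds hy.2)).differentiableAt one_ne_zero)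
    rwa [fderiv_fun_sub d1 d2] at h1

variable [IsManifold (𝓡 n) ∞ M]

theorem contDiffAt_rep_glue {χ : SmoothPartitionOfUnity M (𝓡 n) M univ} {U : M → Set (E n)}
    (hU : ∀ i, IsOpen (U i))
    (hχ : χ.IsSubordinate fun i => (chartAt (E n) i).source ∩ chartAt (E n) i ⁻¹' U i)
    {F : M → ℝ → E n → E n →L[ℝ] E n →L[ℝ] ℝ}
    (hF : ∀ i, ContDiffOn ℝ ∞ (fun q : ℝ × E n => F i q.1 q.2) (Ioi 0 ×ˢ U i))
    {φ : OpenPartialHomeomorph M (E n)} (hφ : φ ∈ IsManifold.maximalAtlas (𝓡 n) ∞ M) {x₁ : E n}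
    (hx₁ : x₁ ∈ φ.target) {ε : ℝ} (hε : 0 < ε) :
    ContDiffAt ℝ ∞ (fun q : ℝ × E n => rep (glue χ fun i => F i q.1) φ q.2) (ε, x₁) := by
  obtain ⟨I, ψ, a, hI, s, hs, hso, hrep⟩ := exists_rep_glue hχ hφ hx₁
  have hev : (fun q : ℝ × E n => rep (glue χ fun i => F i q.1) φ q.2) =ᶠ[𝓝 (ε, x₁)]
      fun q => ∑ i ∈ I, a i q.2 (F i q.1 (ψ i q.2)) := by
    filter_upwards [continuousAt_snd.eventually_mem hs] with q hq
    exact hrep _ _ hq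
  refine ContDiffAt.congr_of_eventuallyEq (ContDiffAt.sum fun i hi => ?_) hev
  obtain ⟨hψ, hψU, ha⟩ := hI i hi
  have h1 : ContDiffAt ℝ ∞ (fun q : ℝ × E n => (q.1, ψ i q.2)) (ε, x₁) :=
    contDiffAt_fst.prodMk (hψ.comp (ε, x₁) contDiffAt_snd)
  have h2 : ContDiffAt ℝ ∞ (fun q : ℝ × E n => F i q.1 q.2) (ε, ψ i x₁) :=
    (hF i).contDiffAt ((isOpen_Ioi.prod (hU i)).mem_nhds ⟨hε, hψU⟩)
  have h3 : ContDiffAt ℝ ∞ (fun q : ℝ × E n => F i q.1 (ψ i q.2)) (ε, x₁) :=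
    ContDiffAt.comp (ε, x₁) (f := fun q : ℝ × E n => (q.1, ψ i q.2)) h2 h1
  exact (ha.comp (ε, x₁) contDiffAt_snd).clm_apply h3

theorem exists_approxOn_rep_glue {χ : SmoothPartitionOfUnity M (𝓡 n) M univ} {U : M → Set (E n)}
    (hU : ∀ i, IsOpen (U i))
    (hχ : χ.IsSubordinate fun i => (chartAt (E n) i).source ∩ chartAt (E n) i ⁻¹' U i)
    {F : M → ℝ → E n → E n →L[ℝ] E n →L[ℝ] ℝ} {G : M → E n → E n →L[ℝ] E n →L[ℝ] ℝ}
    (hF : ∀ i, ∀ ε > 0, ContDiffOn ℝ ∞ (F i ε) (U i)) (hG : ∀ i, ContDiffOn ℝ 1 (G i) (U i))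
    (h : ∀ i, ApproxOn (F i) (G i) (U i))
    {φ : OpenPartialHomeomorph M (E n)} (hφ : φ ∈ IsManifold.maximalAtlas (𝓡 n) ∞ M) {x₁ : E n}
    (hx₁ : x₁ ∈ φ.target) :
    ∃ s ∈ 𝓝 x₁, ApproxOn (fun ε => rep (glue χ fun i => F i ε) φ) (rep (glue χ G) φ) s := by
  obtain ⟨I, ψ, a, hI, s, hs, hso, hrep⟩ := exists_rep_glue hχ hφ hx₁
  have key := fun i (hi : i ∈ I) => (h i).exists_clm_apply_comp (hU i) (hF i) (hG i) (hI i hi).1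
    (hI i hi).2.1 (hI i hi).2.2
  choose! t ht hto hG' hF' ha using key
  set T := s ∩ ⋂ i ∈ I, t i with hT
  have hTo : IsOpen T := hso.inter (isOpen_biInter_finset hto)
  have hTt : ∀ i ∈ I, T ⊆ t i := fun i hi => inter_subset_right.trans (biInter_subset_of_mem hi)
  refine ⟨T, inter_mem hs ((Filter.biInter_finset_mem I).2 ht), ?_⟩
  refine ApproxOn.congr hTo (ApproxOn.sum (I := I) hTo (fun i hi => (hG' i hi).mono (hTt i hi))
    (fun i hi ε hε => (hF' i hi ε hε).mono (hTt i hi)) fun i hi => (ha i hi).mono (hTt i hi))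
    (fun ε x hx => hrep _ _ hx.1) fun x hx => hrep _ _ hx.1

/-- One partition of unity, independent of `ε`, glues the local families. The fibre conditions
survive by convexity, and the derivative estimates by local finiteness. -/
theorem exists_good_family [T2Space M] [SigmaCompactSpace M] {σ : ℝ} (hσ : σ = 1 ∨ σ = -1)
    (g : TensorField n M) (hg_cont : g.IsContinuous) (hg_lor : g.IsLorentzian)
    (h : ContMDiffRiemannianMetric (𝓡 n) ∞ (E n) (fun p : M => TangentSpace (𝓡 n) p)) :
    ∃ gε : ℝ → TensorField n M, SmoothFamily gε ∧
      (∀ ε > 0, ∀ p, GoodForm σ ε (g p) (h.inner p) (gε ε p)) ∧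
      (g.IsC11 → ConvergesC1 gε g ∧ SecondDerivBounded gε) := by
  have hlocal : ∀ p : M, ∃ r > 0, Metric.ball (chartAt (E n) p p) r ⊆ (chartAt (E n) p).target ∧
      ∃ F : ℝ → E n → E n →L[ℝ] E n →L[ℝ] ℝ,
        ContDiffOn ℝ ∞ (fun q : ℝ × E n => F q.1 q.2)
          (Ioi 0 ×ˢ Metric.ball (chartAt (E n) p p) r) ∧
        (∀ ε > 0, ∀ x ∈ Metric.ball (chartAt (E n) p p) r, GoodForm σ ε
          (rep g (chartAt (E n) p) x) (rep h.inner (chartAt (E n) p) x) (F ε x)) ∧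
        (C11On (rep g (chartAt (E n) p)) (chartAt (E n) p).target →
          ApproxOn F (rep g (chartAt (E n) p)) (Metric.ball (chartAt (E n) p p) r)) := by
    intro p
    have hat := IsManifold.chart_mem_maximalAtlas (I := 𝓡 n) (n := ∞) p
    have hp := mem_chart_source (E n) p
    have hinv := (chartAt (E n) p).left_inv hp
    have hh_cont : TensorField.IsContinuous (n := n) (M := M) h.inner := h.contMDiff.continuous
    refine exists_local_family hσ (chartAt (E n) p).open_target (mem_chart_target (E n) p)
      (hg_cont.continuousOn_rep p) (hh_cont.continuousOn_rep p)
      (fun x hx X Y => (hg_lor _).1 _ _) ?_ ?_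
    · have : rep g (chartAt (E n) p) (chartAt (E n) p p) = pull (g p)
          (mfderiv (𝓡 n) (𝓡 n) (chartAt (E n) p).symm (chartAt (E n) p p) : E n →L[ℝ] E n) := by
        ext u v
        exact g.apply_congr hinv _ _
      rw [this]
      exact LorentzForm.pull (hg_lor p) _ (mfderiv (𝓡 n) (𝓡 n) (chartAt (E n) p) p : E n →L[ℝ] E n)
        (deriv_symm_deriv hat hp) (symm_deriv_deriv hat hp)
    · intro w hw
      refine h.pos _ _ fun h0 => hw ?_
      have h1 := deriv_symm_deriv hat hp w
      have h2 : (mfderiv (𝓡 n) (𝓡 n) (chartAt (E n) p).symm (chartAt (E n) p p) w : E n) = 0 := h0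
      rw [h2] at h1
      rw [← h1]
      exact map_zero _
  choose r hr hrt F hF1 hF2 hF3 using hlocal
  set U : M → Set (E n) := fun p => Metric.ball (chartAt (E n) p p) (r p) with hU
  have hUo : ∀ i, IsOpen (U i) := fun i => Metric.isOpen_ball
  obtain ⟨χ, hχ⟩ := SmoothPartitionOfUnity.exists_isSubordinate (𝓡 n) (isClosed_univ (X := M))
    (fun i => (chartAt (E n) i).source ∩ chartAt (E n) i ⁻¹' U i)
    (fun i => (chartAt (E n) i).continuousOn.isOpen_inter_preimage
      (chartAt (E n) i).open_source (hUo i))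
    (fun p _ => mem_iUnion.2 ⟨p, mem_chart_source (E n) p, Metric.mem_ball_self (hr p)⟩)
  have hχ' : χ.IsSubordinate fun i => (chartAt (E n) i).source := fun i =>
    (hχ i).trans inter_subset_left
  set gε : ℝ → TensorField n M := fun ε => glue χ fun i => F i ε with hgε
  have hsm : ∀ φ ∈ IsManifold.maximalAtlas (𝓡 n) ∞ M, ∀ x ∈ φ.target, ∀ ε > 0,
      ContDiffAt ℝ ∞ (fun q : ℝ × E n => rep (gε q.1) φ q.2) (ε, x) := fun φ hφ x hx ε hε =>
    contDiffAt_rep_glue hUo hχ hF1 hφ hx hε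
  refine ⟨gε, smoothFamily_of_rep fun p ε hε => hsm _ (IsManifold.chart_mem_maximalAtlas p) _
    (mem_chart_target (E n) p) ε hε, fun ε hε p => ?_, fun hC11 => ?_⟩
  · refine (convex_goodForm σ ε (g p) (h.inner p)).finsum_mem (fun i => χ.nonneg i p)
      (χ.sum_eq_one (mem_univ p)) fun i hi => ?_
    obtain ⟨h1, h2⟩ := hχ i (subset_tsupport _ hi)
    exact GoodForm.ofRep (h := h.inner) (IsManifold.chart_mem_maximalAtlas i) h1 (hF2 i ε hε _ h2)
  · have hsm' : ∀ φ ∈ IsManifold.maximalAtlas (𝓡 n) ∞ M, ∀ x ∈ φ.target, ∀ ε > 0,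
        ContDiffAt ℝ ∞ (rep (gε ε) φ) x := fun φ hφ x hx ε hε =>
      ContDiffAt.comp x (f := fun y : E n => (ε, y)) (hsm φ hφ x hx ε hε)
        (contDiffAt_const.prodMk contDiffAt_id)
    have hrep : ∀ φ ∈ IsManifold.maximalAtlas (𝓡 n) ∞ M, C11On (rep g φ) φ.target :=
      fun φ hφ => hC11.c11On_rep hφ
    have happ : ∀ φ ∈ IsManifold.maximalAtlas (𝓡 n) ∞ M, ∀ x ∈ φ.target, ∃ s ∈ 𝓝 x,
        ApproxOn (fun ε => rep (gε ε) φ) (rep g φ) s := by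
      intro φ hφ x hx
      have := exists_approxOn_rep_glue hUo hχ (F := F) (G := fun i => rep g (chartAt (E n) i))
        (fun i ε hε => (hF1 i).comp (contDiffOn_const.prodMk contDiffOn_id) fun y hy => ⟨hε, hy⟩)
        (fun i => (hrep _ (IsManifold.chart_mem_maximalAtlas i)).1.mono (hrt i))
        (fun i => hF3 i (hrep _ (IsManifold.chart_mem_maximalAtlas i))) hφ hx
      rwa [glue_rep hχ'] at this
    exact ⟨convergesC1_of_approxOn hsm' (fun φ hφ => (hrep φ hφ).1) happ,
      secondDerivBounded_of_approxOn hsm' happ⟩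

end Family

/-! ### The distance bound and the conclusion -/

section Main

variable {n : ℕ} {M : Type*} [TopologicalSpace M] [ChartedSpace (E n) M] [IsManifold (𝓡 n) ∞ M]

theorem distWrt_le {h : ContMDiffRiemannianMetric (𝓡 n) ∞ (E n)
    (fun p : M => TangentSpace (𝓡 n) p)} {g₁ g₂ : TensorField n M} {r : ℝ}
    (hr : ∀ p, CloseForm (h.inner p) r (g₁ p) (g₂ p)) : distWrt h g₁ g₂ ≤ ENNReal.ofReal r := by
  refine iSup_le fun p => iSup_le fun X => iSup_le fun Y => iSup_le fun hX => iSup_le fun hY => ?_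
  refine ENNReal.ofReal_le_ofReal ?_
  have h1 : 0 < √(h.inner p X X) := Real.sqrt_pos.2 (h.pos p X hX)
  have h2 : 0 < √(h.inner p Y Y) := Real.sqrt_pos.2 (h.pos p Y hY)
  exact (div_le_iff₀ (mul_pos h1 h2)).2 (hr p X Y)

end Main

end LorentzApprox

end

theorem mainTheorem3 {n : ℕ} {M : Type*} [TopologicalSpace M] [T2Space M] [SigmaCompactSpace M]
    [ChartedSpace (LorentzApprox.E n) M] [IsManifold (𝓡 n) ∞ M]
    (g : LorentzApprox.TensorField n M) (hg_cont : g.IsContinuous) (hg_lor : g.IsLorentzian)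
    (hg_time : g.TimeOrientable)
    (h : ContMDiffRiemannianMetric (𝓡 n) ∞ (LorentzApprox.E n)
      (fun p : M => TangentSpace (𝓡 n) p)) :
    ∃ gCheck gHat : ℝ → LorentzApprox.TensorField n M,
      (∀ ε : ℝ, 0 < ε →
        (gCheck ε).IsSmooth ∧ (gCheck ε).IsLorentzian ∧
        (gHat ε).IsSmooth ∧ (gHat ε).IsLorentzian ∧
        LorentzApprox.StrictlyLargerCones (gCheck ε) g ∧
        LorentzApprox.StrictlyLargerCones g (gHat ε) ∧
        LorentzApprox.distWrt h (gCheck ε) g + LorentzApprox.distWrt h (gHat ε) g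
          < ENNReal.ofReal ε) ∧
      LorentzApprox.SmoothFamily gCheck ∧ LorentzApprox.SmoothFamily gHat ∧
      (g.IsC11 →
        LorentzApprox.ConvergesC1 gCheck g ∧ LorentzApprox.SecondDerivBounded gCheck ∧
        LorentzApprox.ConvergesC1 gHat g ∧ LorentzApprox.SecondDerivBounded gHat) := by
  obtain ⟨gCheck, hc1, hc2, hc3⟩ :=
    LorentzApprox.exists_good_family (σ := 1) (Or.inl rfl) g hg_cont hg_lor h
  obtain ⟨gHat, hh1, hh2, hh3⟩ :=
    LorentzApprox.exists_good_family (σ := -1) (Or.inr rfl) g hg_cont hg_lor h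
  refine ⟨gCheck, gHat, fun ε hε => ⟨hc1.isSmooth hε, fun p => (hc2 ε hε p).lorentzForm,
    hh1.isSmooth hε, fun p => (hh2 ε hε p).lorentzForm, fun p X hX hle => ?_,
    fun p X hX hle => ?_, ?_⟩, hc1, hh1, fun hC => ⟨(hc3 hC).1, (hc3 hC).2, hh3 hC⟩⟩
  -- For `σ = 1` the cone condition says that `0 ≤ g X X` forces `0 < gCheck X X`; the claim is its
  -- contrapositive.
  · by_contra hlt
    have := (hc2 ε hε p).2.1 X hX (by linarith)
    linarith
  · have := (hh2 ε hε p).2.1 X hX (by linarith)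
    linarith
  -- Each distance is at most `ε / 3`, which leaves room for the strict inequality.
  · refine (add_le_add (LorentzApprox.distWrt_le fun p => (hc2 ε hε p).closeForm)
      (LorentzApprox.distWrt_le fun p => (hh2 ε hε p).closeForm)).trans_lt ?_
    rw [← ENNReal.ofReal_add (by positivity) (by positivity)]
    exact (ENNReal.ofReal_lt_ofReal_iff hε).2 (by linarith)
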